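/- \textbf{Setting.} Let $\mathbb K$ be a field of characteristic zero, let $\mathcal P\subseteq S^1$ be a set of points on the oriented circle and let $n\ge 2$. Let $\mathcal Z(\mathcal P)$ be the commutative ring $\mathbb K[\{xy\}_{x,y\in\mathcal P}]/(xx : x\in\mathcal P)$, where $xy$ denotes a variable attached to the ordered pair $(x,y)$. For $r,x,s,y\in\mathcal P$ cut the circle at a point $o\notin\{r,x,s,y\}$, identify $S^1\setminus\{o\}$ with $]0,1[$ (anticlockwise increasing), and let $$\mathcal J(rx,sy)=\tfrac12\bigl(\triangle(r-x)\triangle(r-y)\triangle(y-x)-\triangle(r-x)\triangle(r-s)\triangle(s-x)\bigr),$$ where $\triangle(a)\in\{-1,0,1\}$ is the sign of $a$ (this does not depend on $o$). The swapping bracket on $\mathcal Z(\mathcal P)$ is the $\mathbb K$-bilinear bracket obtained by extending $\{rx,sy\}=\mathcal J(rx,sy)\cdot ry\cdot sx$ by Leibniz's rule in both arguments. Put $\Delta((x_1,\dots,x_m),(y_1,\dots,y_m))=\det(x_iy_j)_{i,j=1}^m$, let $R_n(\mathcal P)$ be the ideal generated by all $\Delta((x_1,\dots,x_{n+1}),(y_1,\dots,y_{n+1}))$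 with $x_i,y_j\in\mathcal P$, let $\mathcal Z_n(\mathcal P)=\mathcal Z(\mathcal P)/R_n(\mathcal P)$, and let $\mathcal Q_n(\mathcal P)$ be the total fraction ring of $\mathcal Z_n(\mathcal P)$; the bracket descends to $\mathcal Z_n(\mathcal P)$ and extends to $\mathcal Q_n(\mathcal P)$. Write $[a,b]=\{a,b\}/(a\cdot b)$ for units $a,b$ of $\mathcal Q_n(\mathcal P)$, and write $x^a$ for $x_1,\dots,x_a$. \textbf{Proposition.} Let $x_1,\dots,x_{n-1}$, $y_1,\dots,y_{n-1}$, $z_1,\dots,z_{n-1}$, $v_1,\dots,v_n$, $u_1,\dots,u_n$ be pairwise distinct points of $\mathcal P$ which occur anticlockwise on the circle in the cyclic order $$x_{n-1},\dots,x_1,\;v_1,\dots,v_n,\;y_{n-1},\dots,y_1,\;z_{n-1},\dots,z_1,\;u_1,\dots,u_n .$$ Let $m,l,p,m',l',p'\in\{0,\dots,n-1\}$ with $m+l+p=n$ and $m'+l'+p'=n$, and suppose that $l\ge l'$ or $p\le p'$. Then $\Delta((x^m,y^l,z^p),v^n)$ and $\Delta((x^{m'},y^{l'},z^{p'}),u^n)$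 are units of $\mathcal Q_n(\mathcal P)$, and $$\bigl[\Delta((x^m,y^l,z^p),v^n),\,\Delta((x^{m'},y^{l'},z^{p'}),u^n)\bigr]=\tfrac12\min\{m,m'\}-\tfrac12\min\{l,l'\}-\tfrac12\min\{p,p'\}$$ in $\mathcal Q_n(\mathcal P)$. -/

import Mathlib

noncomputable section

namespace Swapping

/-! ## Points on the circle and the linking number -/

/-- The coordinate on the oriented circle cut at `o`: removing `o` identifies the rest of the
circle with the open interval `(0, 1)`, increasing in the anticlockwise direction. -/
def coord (o a : UnitAddCircle) : ℝ := (AddCircle.equivIco (1 : ℝ) 0 (a - o) : ℝ)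

/-- The signature of a real number: `-1`, `0` or `1`. -/
def signature (a : ℝ) : ℚ := ((SignType.sign a : SignType) : ℚ)

/-- The linking number of `rx` and `sy`, computed after cutting the circle at `o`. -/
def linkingNumberAt (o r x s y : UnitAddCircle) : ℚ :=
  1 / 2 *
    (signature (coord o r - coord o x) * signature (coord o r - coord o y)
        * signature (coord o y - coord o x)
      - signature (coord o r - coord o x) * signature (coord o r - coord o s)
        * signature (coord o s - coord o x))

theorem exists_cut_finset (S : Finset UnitAddCircle) : ∃ o, o ∉ S := by
  have : Infinite UnitAddCircle := by
    have h : Infinite (Set.Ico (0 : ℝ) (0 + 1)) := (Set.Ico_infinite (by norm_num)).to_subtype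
    exact (AddCircle.equivIco (1 : ℝ) 0).symm.infinite_iff.mp h
  exact Infinite.exists_notMem_finset S

theorem exists_cut (r x s y : UnitAddCircle) : ∃ o, o ≠ r ∧ o ≠ x ∧ o ≠ s ∧ o ≠ y := by
  classical
  obtain ⟨o, ho⟩ := exists_cut_finset {r, x, s, y}
  simp only [Finset.mem_insert, Finset.mem_singleton, not_or] at ho
  exact ⟨o, ho⟩

/-- The linking number of `rx` and `sy`: cut the circle at any point `o` different from
`r, x, s, y` (the value does not depend on `o`, see `linkingNumber_eq`). -/
def linkingNumber (r x s y : UnitAddCircle) : ℚ :=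
  linkingNumberAt (Classical.choose (exists_cut r x s y)) r x s y

theorem coord_mem (o a : UnitAddCircle) : coord o a ∈ Set.Ico (0 : ℝ) 1 := by
  have h := (AddCircle.equivIco (1 : ℝ) 0 (a - o)).2
  simpa [coord] using h

theorem coe_coord (o a : UnitAddCircle) : ((coord o a : ℝ) : UnitAddCircle) = a - o :=
  AddCircle.coe_equivIco

theorem coord_eq_of_coe {o a : UnitAddCircle} {t : ℝ} (ht : t ∈ Set.Ico (0 : ℝ) 1)
    (h : ((t : ℝ) : UnitAddCircle) = a - o) : coord o a = t := by
  have h1 : (AddCircle.equivIco (1 : ℝ) 0 (t : UnitAddCircle) : ℝ) = t :=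
    AddCircle.equivIco_coe_of_mem (by simpa using ht)
  rw [coord, ← h, h1]

theorem coord_change (o o' a : UnitAddCircle) (ha : a ≠ o') :
    (coord o o' < coord o a ∧ coord o' a = coord o a - coord o o') ∨
      (coord o a < coord o o' ∧ coord o' a = coord o a - coord o o' + 1) := by
  have h1 := coord_mem o o'
  have h2 := coord_mem o a
  have hc : (((coord o a - coord o o' : ℝ)) : UnitAddCircle) = a - o' := by
    rw [AddCircle.coe_sub, coe_coord, coe_coord]; abel
  have hone : ((1 : ℝ) : UnitAddCircle) = 0 := AddCircle.coe_period 1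
  rcases lt_trichotomy (coord o o') (coord o a) with h | h | h
  · exact Or.inl ⟨h, coord_eq_of_coe ⟨by linarith, by linarith [h1.1, h2.2]⟩ hc⟩
  · exfalso
    apply ha
    have h3 := coe_coord o o'
    rw [h, coe_coord] at h3
    simpa using h3
  · refine Or.inr ⟨h, coord_eq_of_coe ⟨by linarith [h1.2, h2.1], by linarith⟩ ?_⟩
    rw [AddCircle.coe_add, hc, hone, add_zero]

theorem signature_pos {a : ℝ} (h : 0 < a) : signature a = 1 := by simp [signature, h]

theorem signature_neg {a : ℝ} (h : a < 0) : signature a = -1 := by simp [signature, h]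

theorem signature_zero : signature 0 = 0 := by simp [signature]

/-- The product of signatures occurring in the linking number does not depend on the cut. -/
theorem triple_eq (o o' r x t : UnitAddCircle) (hr : r ≠ o') (hx : x ≠ o') (ht : t ≠ o') :
    signature (coord o' r - coord o' x) * signature (coord o' r - coord o' t)
        * signature (coord o' t - coord o' x)
      = signature (coord o r - coord o x) * signature (coord o r - coord o t)
        * signature (coord o t - coord o x) := by
  have b1 := coord_mem o r
  have b2 := coord_mem o x
  have b3 := coord_mem o t
  have key : ∀ a b : UnitAddCircle, a ≠ o' → b ≠ o' →
      coord o o' < coord o a → coord o b < coord o o' →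
      signature (coord o a - coord o b) = 1 ∧ signature (coord o b - coord o a) = -1 :=
    fun a b _ _ h h' => ⟨signature_pos (by linarith), signature_neg (by linarith)⟩
  have key' : ∀ a b : UnitAddCircle,
      signature (coord o a - coord o o' - (coord o b - coord o o' + 1)) = -1 ∧
      signature (coord o b - coord o o' + 1 - (coord o a - coord o o')) = 1 := fun a b => by
    have ba := coord_mem o a
    have bb := coord_mem o b
    exact ⟨signature_neg (by linarith [ba.2, bb.1]), signature_pos (by linarith [ba.2, bb.1])⟩
  have e1 : ∀ a b c : ℝ, a - c - (b - c) = a - b := fun a b c => by ring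
  have e2 : ∀ a b c : ℝ, a - c + 1 - (b - c + 1) = a - b := fun a b c => by ring
  rcases coord_change o o' r hr with ⟨h1, h1'⟩ | ⟨h1, h1'⟩ <;>
  rcases coord_change o o' x hx with ⟨h2, h2'⟩ | ⟨h2, h2'⟩ <;>
  rcases coord_change o o' t ht with ⟨h3, h3'⟩ | ⟨h3, h3'⟩ <;>
  rw [h1', h2', h3'] <;>
  simp only [e1, e2] <;>
  simp_all only [ne_eq, not_false_eq_true] <;> ring

theorem linkingNumberAt_eq (o o' r x s y : UnitAddCircle)
    (hr : r ≠ o') (hx : x ≠ o') (hs : s ≠ o') (hy : y ≠ o') :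
    linkingNumberAt o' r x s y = linkingNumberAt o r x s y := by
  unfold linkingNumberAt
  rw [triple_eq o o' r x y hr hx hy, triple_eq o o' r x s hr hx hs]

theorem linkingNumber_eq (o r x s y : UnitAddCircle) :
    linkingNumber r x s y = linkingNumberAt o r x s y := by
  have h := Classical.choose_spec (exists_cut r x s y)
  exact linkingNumberAt_eq o _ r x s y h.1.symm h.2.1.symm h.2.2.1.symm h.2.2.2.symm

theorem linkingNumber_self_left (r s y : UnitAddCircle) : linkingNumber r r s y = 0 := by
  simp [linkingNumber, linkingNumberAt, signature_zero]

theorem signature_cases (a b : ℝ) :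
    (a < b ∧ signature (a - b) = -1 ∧ signature (b - a) = 1) ∨
    (a = b ∧ signature (a - b) = 0 ∧ signature (b - a) = 0) ∨
    (b < a ∧ signature (a - b) = 1 ∧ signature (b - a) = -1) := by
  rcases lt_trichotomy a b with h | h | h
  · exact Or.inl ⟨h, signature_neg (by linarith), signature_pos (by linarith)⟩
  · subst h; simp [signature_zero]
  · exact Or.inr (Or.inr ⟨h, signature_pos (by linarith), signature_neg (by linarith)⟩)

theorem linkingNumber_antisymm (r x s y : UnitAddCircle) :
    linkingNumber s y r x = -linkingNumber r x s y := by
  rw [linkingNumber_eq 0 s y r x, linkingNumber_eq 0 r x s y]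
  unfold linkingNumberAt
  generalize coord 0 r = r, coord 0 x = x, coord 0 s = s, coord 0 y = y
  rcases signature_cases r x with ⟨h1, h1', h1''⟩ | ⟨h1, h1', h1''⟩ | ⟨h1, h1', h1''⟩ <;>
  rcases signature_cases s x with ⟨h2, h2', h2''⟩ | ⟨h2, h2', h2''⟩ | ⟨h2, h2', h2''⟩ <;>
  rcases signature_cases r s with ⟨h3, h3', h3''⟩ | ⟨h3, h3', h3''⟩ | ⟨h3, h3', h3''⟩ <;>
  first
  | (exfalso; linarith)
  | (rcases signature_cases y r with ⟨h4, h4', h4''⟩ | ⟨h4, h4', h4''⟩ | ⟨h4, h4', h4''⟩ <;>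
     rcases signature_cases y s with ⟨h5, h5', h5''⟩ | ⟨h5, h5', h5''⟩ | ⟨h5, h5', h5''⟩ <;>
     first
     | (exfalso; linarith)
     | (rcases signature_cases y x with ⟨h6, h6', h6''⟩ | ⟨h6, h6', h6''⟩ | ⟨h6, h6', h6''⟩ <;>
        first
        | (exfalso; linarith)
        | (simp only [h1', h2', h3', h3'', h4'', h5'', h6', h6'']; norm_num)))

/-- The position of `t` with respect to the arc from `r` to `x`, read after cutting at `o`. -/
def arcSide (o r x t : UnitAddCircle) : ℚ :=
  1 / 2 * (signature (coord o r - coord o x) * signature (coord o r - coord o t)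
    * signature (coord o t - coord o x))

theorem linkingNumber_eq_sub (r x s y : UnitAddCircle) :
    linkingNumber r x s y = arcSide 0 r x y - arcSide 0 r x s := by
  rw [linkingNumber_eq 0, linkingNumberAt, arcSide, arcSide]; ring

/-- The points of the list occur in this order (and are distinct) when one runs once through the
circle anticlockwise, starting from some point `o` outside the list. -/
def OrderedAnticlockwise (L : List UnitAddCircle) : Prop :=
  ∃ o, o ∉ L ∧ L.Pairwise fun a b => coord o a < coord o b

/-! ## Brackets: bilinear maps that are derivations in each argument -/

section Brackets

/-- A `K`-bilinear bracket on a commutative `K`-algebra that satisfies Leibniz's rule in both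
arguments: `f ↦ {f, ·}` is a derivation with values in the module of derivations. -/
abbrev Biderivation (K A : Type*) [CommRing K] [CommRing A] [Algebra K A] :=
  Derivation K A (Derivation K A A)

variable {K A : Type*} [CommRing K] [CommRing A] [Algebra K A]

/-- The ideal `I` is stable under the bracket with arbitrary elements. -/
def Biderivation.Preserves (B : Biderivation K A) (I : Ideal A) : Prop :=
  ∀ f ∈ I, ∀ g, B f g ∈ I ∧ B g f ∈ I

/-- A derivation preserving `I` descends to `A ⧸ I`. -/
def quotientDerivation (I : Ideal A) (D : Derivation K A A) (hD : ∀ f ∈ I, D f ∈ I) :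
    Derivation K (A ⧸ I) (A ⧸ I) :=
  Derivation.liftOfSurjective (f := Ideal.Quotient.mkₐ K I) (d := D)
    (Ideal.Quotient.mkₐ_surjective K I)
    (fun x hx => by
      rw [Ideal.Quotient.mkₐ_eq_mk, Ideal.Quotient.eq_zero_iff_mem] at hx ⊢
      exact hD x hx)

theorem quotientDerivation_mk (I : Ideal A) (D : Derivation K A A) (hD : ∀ f ∈ I, D f ∈ I)
    (f : A) : quotientDerivation I D hD (Ideal.Quotient.mk I f) = Ideal.Quotient.mk I (D f) := by
  unfold quotientDerivation
  exact Derivation.liftOfSurjective_apply (f := Ideal.Quotient.mkₐ K I)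
    (Ideal.Quotient.mkₐ_surjective K I) _ f

theorem derivation_quotient_ext {I : Ideal A} {D₁ D₂ : Derivation K (A ⧸ I) (A ⧸ I)}
    (h : ∀ f : A, D₁ (Ideal.Quotient.mk I f) = D₂ (Ideal.Quotient.mk I f)) : D₁ = D₂ := by
  ext q
  obtain ⟨f, rfl⟩ := Ideal.Quotient.mk_surjective q
  exact h f

/-- The derivation `{f, ·}` of `A ⧸ I`. -/
def Biderivation.quotientAux (B : Biderivation K A) (I : Ideal A) (hI : B.Preserves I) (f : A) :
    Derivation K (A ⧸ I) (A ⧸ I) :=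
  quotientDerivation I (B f) (fun g hg => (hI g hg f).2)

theorem Biderivation.quotientAux_eq (B : Biderivation K A) (I : Ideal A) (hI : B.Preserves I) {f g : A}
    (h : Ideal.Quotient.mk I f = Ideal.Quotient.mk I g) :
    B.quotientAux I hI f = B.quotientAux I hI g := by
  refine derivation_quotient_ext fun k => ?_
  simp only [Biderivation.quotientAux, quotientDerivation_mk]
  rw [Ideal.Quotient.eq] at h ⊢
  simpa using (hI _ h k).1

/-- The bracket induced on the quotient by an ideal that it preserves. -/
def Biderivation.quotient (B : Biderivation K A) (I : Ideal A) (hI : B.Preserves I) :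
    Biderivation K (A ⧸ I) :=
  have hs (q : A ⧸ I) : Ideal.Quotient.mk I
      (Function.surjInv Ideal.Quotient.mk_surjective q) = q := Function.surjInv_eq _ q
  have hsmul (c : K) (q : A ⧸ I) : Ideal.Quotient.mk I
      (Function.surjInv Ideal.Quotient.mk_surjective (c • q)) =
        Ideal.Quotient.mk I (c • Function.surjInv Ideal.Quotient.mk_surjective q) :=
    (hs (c • q)).trans ((congrArg (fun t => c • t) (hs q).symm).trans
      (map_smul (Ideal.Quotient.mkₐ K I) c _).symm)
  Derivation.mk'
    { toFun := fun q =>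
        B.quotientAux I hI (Function.surjInv Ideal.Quotient.mk_surjective q)
      map_add' := fun p q => by
        rw [B.quotientAux_eq I hI (g := Function.surjInv Ideal.Quotient.mk_surjective p
          + Function.surjInv Ideal.Quotient.mk_surjective q) (by rw [map_add, hs, hs, hs])]
        refine derivation_quotient_ext fun k => ?_
        simp [Biderivation.quotientAux, quotientDerivation_mk]
      map_smul' := fun c q => by
        rw [B.quotientAux_eq I hI (g := c • Function.surjInv Ideal.Quotient.mk_surjective q)
          (hsmul c q)]
        refine derivation_quotient_ext fun k => ?_
        simp only [Biderivation.quotientAux, quotientDerivation_mk, Derivation.smul_apply,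
          RingHom.id_apply]
        rw [Derivation.map_smul, Derivation.smul_apply]
        exact map_smul (Ideal.Quotient.mkₐ K I) c _ }
    (fun p q => by
      simp only [LinearMap.coe_mk, AddHom.coe_mk]
      rw [B.quotientAux_eq I hI (g := Function.surjInv Ideal.Quotient.mk_surjective p
          * Function.surjInv Ideal.Quotient.mk_surjective q) (by rw [map_mul, hs, hs, hs])]
      refine derivation_quotient_ext fun k => ?_
      simp only [Biderivation.quotientAux, quotientDerivation_mk, Derivation.leibniz,
        Derivation.add_apply, Derivation.smul_apply, smul_eq_mul, map_add, map_mul, hs])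

theorem Biderivation.quotient_mk (B : Biderivation K A) (I : Ideal A) (hI : B.Preserves I) (f g : A) :
    B.quotient I hI (Ideal.Quotient.mk I f) (Ideal.Quotient.mk I g)
      = Ideal.Quotient.mk I (B f g) := by
  have hs := Function.surjInv_eq (Ideal.Quotient.mk_surjective (I := I)) (Ideal.Quotient.mk I f)
  have h : B.quotient I hI (Ideal.Quotient.mk I f) = B.quotientAux I hI f :=
    B.quotientAux_eq I hI hs
  rw [h, Biderivation.quotientAux, quotientDerivation_mk]

/-- Stability under the bracket may be tested on generators of the ring and of the ideal. -/
theorem Biderivation.preserves_span (B : Biderivation K A) (G S : Set A) (hG : Algebra.adjoin K G = ⊤)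
    (h : ∀ s ∈ S, ∀ g ∈ G, B s g ∈ Ideal.span S ∧ B g s ∈ Ideal.span S) :
    B.Preserves (Ideal.span S) := by
  have h1 : ∀ s ∈ S, ∀ g : A, B s g ∈ Ideal.span S ∧ B g s ∈ Ideal.span S := by
    intro s hs g
    have hg : g ∈ Algebra.adjoin K G := hG ▸ Algebra.mem_top
    induction hg using Algebra.adjoin_induction with
    | mem g hg => exact h s hs g hg
    | algebraMap r => simp
    | add f g _ _ hf hg =>
      simp only [map_add, Derivation.add_apply]
      exact ⟨add_mem hf.1 hg.1, add_mem hf.2 hg.2⟩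
    | mul f g _ _ hf hg =>
      simp only [Derivation.leibniz, Derivation.add_apply, Derivation.smul_apply, smul_eq_mul]
      exact ⟨add_mem (Ideal.mul_mem_left _ _ hg.1) (Ideal.mul_mem_left _ _ hf.1),
        add_mem (Ideal.mul_mem_left _ _ hg.2) (Ideal.mul_mem_left _ _ hf.2)⟩
  intro f hf g
  induction hf using Submodule.span_induction with
  | mem s hs => exact h1 s hs g
  | zero => simp
  | add a b _ _ ha hb =>
    simp only [map_add, Derivation.add_apply]
    exact ⟨add_mem ha.1 hb.1, add_mem ha.2 hb.2⟩
  | smul c a ha' ha =>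
    simp only [smul_eq_mul, Derivation.leibniz, Derivation.add_apply, Derivation.smul_apply]
    exact ⟨add_mem (Ideal.mul_mem_left _ _ ha.1) (Ideal.mul_mem_right _ _ ha'),
      add_mem (Ideal.mul_mem_left _ _ ha.2) (Ideal.mul_mem_right _ _ ha')⟩

/-- The unique extension of a derivation to the total ring of fractions. -/
def localizeDerivation {N : Type*} [AddCommGroup N] [Module K N] [Module A N]
    [Module (FractionRing A) N] [IsScalarTower K A N] [IsScalarTower A (FractionRing A) N]
    [IsScalarTower K (FractionRing A) N]
    (D : Derivation K A N) : Derivation K (FractionRing A) N :=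
  have := Algebra.FormallyEtale.of_isLocalization (Rₘ := FractionRing A) (nonZeroDivisors A)
  ((KaehlerDifferential.isBaseChange_of_formallyEtale K A (FractionRing A)).lift
    D.liftKaehlerDifferential).compDer (KaehlerDifferential.D K (FractionRing A))

theorem localizeDerivation_algebraMap {N : Type*} [AddCommGroup N] [Module K N] [Module A N]
    [Module (FractionRing A) N] [IsScalarTower K A N] [IsScalarTower A (FractionRing A) N]
    [IsScalarTower K (FractionRing A) N] (D : Derivation K A N) (a : A) :
    localizeDerivation D (algebraMap A (FractionRing A) a) = D a := by
  have := Algebra.FormallyEtale.of_isLocalization (Rₘ := FractionRing A) (nonZeroDivisors A)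
  have h := (KaehlerDifferential.isBaseChange_of_formallyEtale K A (FractionRing A)).lift_eq
    D.liftKaehlerDifferential (KaehlerDifferential.D K A a)
  rw [KaehlerDifferential.map_D, Derivation.liftKaehlerDifferential_comp_D] at h
  exact h

theorem derivation_fraction_ext {N : Type*} [AddCommGroup N] [Module K N]
    [Module (FractionRing A) N] [IsScalarTower K (FractionRing A) N]
    {D₁ D₂ : Derivation K (FractionRing A) N}
    (h : ∀ a : A, D₁ (algebraMap A _ a) = D₂ (algebraMap A _ a)) : D₁ = D₂ := by
  ext q
  obtain ⟨⟨a, s⟩, hq⟩ := IsLocalization.surj (nonZeroDivisors A) q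
  simp only at hq
  have hu := IsLocalization.map_units (FractionRing A) s
  have h1 := congrArg D₁ hq
  have h2 := congrArg D₂ hq
  rw [Derivation.leibniz] at h1 h2
  rw [h, h a, ← h2, add_right_inj] at h1
  exact hu.smul_left_cancel.mp h1

/-- The derivation of the total ring of fractions extending a derivation of `A`, as an `A`-linear
map. -/
def localizeDerivationL :
    Derivation K A A →ₗ[A] Derivation K (FractionRing A) (FractionRing A) where
  toFun D := localizeDerivation ((Algebra.linearMap A (FractionRing A)).compDer D)
  map_add' D E := derivation_fraction_ext fun a => by
    simp [localizeDerivation_algebraMap]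
  map_smul' c D := derivation_fraction_ext fun a => by
    simp [localizeDerivation_algebraMap, Algebra.smul_def]

/-- The unique extension of a bracket to the total ring of fractions. -/
def Biderivation.fraction (B : Biderivation K A) : Biderivation K (FractionRing A) :=
  localizeDerivation (localizeDerivationL.compDer B)

theorem Biderivation.fraction_algebraMap (B : Biderivation K A) (f g : A) :
    B.fraction (algebraMap A _ f) (algebraMap A _ g) = algebraMap A (FractionRing A) (B f g) := by
  rw [Biderivation.fraction, localizeDerivation_algebraMap]
  exact localizeDerivation_algebraMap _ g

/-- Antisymmetry of a bracket may be tested on generators of the ring. -/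
theorem Biderivation.antisymm (B : Biderivation K A) (G : Set A) (hG : Algebra.adjoin K G = ⊤)
    (h : ∀ f ∈ G, ∀ g ∈ G, B f g = -B g f) (f g : A) : B f g = -B g f := by
  have h1 : ∀ f ∈ G, ∀ g, B f g = -B g f := by
    intro f hf' g
    have hg : g ∈ Algebra.adjoin K G := hG ▸ Algebra.mem_top
    induction hg using Algebra.adjoin_induction with
    | mem g hg => exact h f hf' g hg
    | algebraMap r => simp
    | add a b _ _ ha hb => simp only [map_add, Derivation.add_apply, ha, hb]; ring
    | mul a b _ _ ha hb =>
      simp only [Derivation.leibniz, Derivation.add_apply, Derivation.smul_apply, smul_eq_mul,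
        ha, hb]
      ring
  have hf : f ∈ Algebra.adjoin K G := hG ▸ Algebra.mem_top
  induction hf using Algebra.adjoin_induction with
  | mem f hf => exact h1 f hf g
  | algebraMap r => simp
  | add a b _ _ ha hb => simp only [map_add, Derivation.add_apply, ha, hb]; ring
  | mul a b _ _ ha hb =>
    simp only [Derivation.leibniz, Derivation.add_apply, Derivation.smul_apply, smul_eq_mul,
      ha, hb]
    ring

theorem derivation_prod {ι : Type*} [DecidableEq ι] (D : Derivation K A A) (s : Finset ι)
    (f : ι → A) : D (∏ i ∈ s, f i) = ∑ i ∈ s, (∏ j ∈ s.erase i, f j) * D (f i) := by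
  induction s using Finset.induction_on with
  | empty => simp
  | insert a s ha ih =>
    rw [Finset.prod_insert ha, Derivation.leibniz, ih, Finset.sum_insert ha,
      Finset.erase_insert ha, smul_eq_mul, smul_eq_mul, add_comm, Finset.mul_sum]
    congr 1
    refine Finset.sum_congr rfl fun i hi => ?_
    have hia : a ≠ i := fun e => ha (e ▸ hi)
    rw [Finset.erase_insert_of_ne hia, Finset.prod_insert (fun e => ha (Finset.mem_of_mem_erase e)),
      mul_assoc]

theorem derivation_det {m : ℕ} (D : Derivation K A A) (M : Matrix (Fin m) (Fin m) A) :
    D M.det = ∑ j, (M.updateCol j fun i => D (M i j)).det := by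
  simp only [Matrix.det_apply]
  rw [map_sum, Finset.sum_comm]
  refine Finset.sum_congr rfl fun σ _ => ?_
  rw [← Finset.smul_sum, Units.smul_def, Units.smul_def, map_zsmul, derivation_prod]
  congr 1
  refine Finset.sum_congr rfl fun j _ => ?_
  rw [← Finset.prod_erase_mul _ _ (Finset.mem_univ j), Matrix.updateCol_self]
  congr 1
  refine Finset.prod_congr rfl fun i hi => ?_
  rw [Matrix.updateCol_ne (Finset.ne_of_mem_erase hi)]

/-- Replacing columns one at a time or rows one at a time gives the same total. -/
theorem sum_updateCol_eq_sum_updateRow {m : ℕ} (M N : Matrix (Fin m) (Fin m) A) :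
    ∑ j, (M.updateCol j fun i => N i j).det = ∑ i, (M.updateRow i (N i)).det := by
  simp only [← Matrix.cramer_apply, ← Matrix.cramer_transpose_apply,
    Matrix.cramer_eq_adjugate_mulVec, Matrix.mulVec, dotProduct, ← Matrix.adjugate_transpose,
    Matrix.transpose_apply]
  exact Finset.sum_comm

end Brackets

/-! ## The swapping algebra -/

section SwappingAlgebra

variable (K : Type*) [Field K] (P : Set UnitAddCircle)

/-- The polynomial ring on the variables `xy`, for ordered pairs of points of `P`. -/
abbrev SwapPoly := MvPolynomial (P × P) K

/-- The swapping bracket on polynomials: `{rx, sy} = 𝓙(rx, sy) · ry · sx` on variables, extended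
by linearity and Leibniz's rule. -/
def polyBracket : Biderivation K (SwapPoly K P) :=
  MvPolynomial.mkDerivation K fun a => MvPolynomial.mkDerivation K fun b =>
    MvPolynomial.C (linkingNumber a.1 a.2 b.1 b.2 : K)
      * (MvPolynomial.X (a.1, b.2) * MvPolynomial.X (b.1, a.2))

/-- The ideal generated by the variables `xx`. -/
def diagIdeal : Ideal (SwapPoly K P) :=
  Ideal.span (Set.range fun x : P => MvPolynomial.X (x, x))

/-- The swapping ring `𝓩(P)`. -/
def SwapRing := SwapPoly K P ⧸ diagIdeal K P

instance : CommRing (SwapRing K P) := inferInstanceAs (CommRing (SwapPoly K P ⧸ diagIdeal K P))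

instance : Algebra K (SwapRing K P) := inferInstanceAs (Algebra K (SwapPoly K P ⧸ diagIdeal K P))

/-- The quotient map from polynomials to the swapping ring. -/
def SwapRing.mk : SwapPoly K P →ₐ[K] SwapRing K P := Ideal.Quotient.mkₐ K (diagIdeal K P)

theorem SwapRing.mk_surjective : Function.Surjective (SwapRing.mk K P) :=
  Ideal.Quotient.mk_surjective

theorem SwapRing.mk_eq_zero_iff (f : SwapPoly K P) : SwapRing.mk K P f = 0 ↔ f ∈ diagIdeal K P :=
  Ideal.Quotient.eq_zero_iff_mem

variable {P}

/-- The generator `xy` of the swapping ring. -/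
def pair (x y : P) : SwapRing K P := SwapRing.mk K P (MvPolynomial.X (x, y))

theorem pair_self (x : P) : pair K x x = 0 :=
  (SwapRing.mk_eq_zero_iff K P _).mpr (Ideal.subset_span ⟨x, rfl⟩)

variable (P)

theorem polyBracket_X (a b : P × P) :
    polyBracket K P (MvPolynomial.X a) (MvPolynomial.X b)
      = MvPolynomial.C (linkingNumber a.1 a.2 b.1 b.2 : K)
        * (MvPolynomial.X (a.1, b.2) * MvPolynomial.X (b.1, a.2)) := by
  rw [polyBracket, MvPolynomial.mkDerivation_X, MvPolynomial.mkDerivation_X]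

theorem polyBracket_preserves : (polyBracket K P).Preserves (diagIdeal K P) := by
  refine Biderivation.preserves_span _ _ _ MvPolynomial.adjoin_range_X ?_
  rintro _ ⟨x, rfl⟩ _ ⟨b, rfl⟩
  simp only [polyBracket_X]
  rw [linkingNumber_antisymm (x : UnitAddCircle) x b.1 b.2, linkingNumber_self_left]
  simp

/-- The swapping bracket on the swapping ring `𝓩(P)`. -/
def swapBracket : Biderivation K (SwapRing K P) :=
  (polyBracket K P).quotient (diagIdeal K P) (polyBracket_preserves K P)

theorem swapBracket_mk (f g : SwapPoly K P) :
    swapBracket K P (SwapRing.mk K P f) (SwapRing.mk K P g)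
      = SwapRing.mk K P (polyBracket K P f g) :=
  Biderivation.quotient_mk _ _ _ f g

variable {P}

theorem swapBracket_pair (r x s y : P) :
    swapBracket K P (pair K r x) (pair K s y)
      = algebraMap K _ (linkingNumber r x s y : K) * (pair K r y * pair K s x) := by
  unfold pair
  rw [swapBracket_mk, polyBracket_X, map_mul, map_mul, ← MvPolynomial.algebraMap_eq,
    AlgHom.commutes]

variable (P)

theorem adjoin_pair :
    Algebra.adjoin K (Set.range fun a : P × P => pair K a.1 a.2) = ⊤ := by
  have h := congrArg (Subalgebra.map (SwapRing.mk K P))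
    (MvPolynomial.adjoin_range_X (R := K) (σ := P × P))
  rw [AlgHom.map_adjoin, Algebra.map_top,
    (AlgHom.range_eq_top _).mpr (SwapRing.mk_surjective K P), ← Set.range_comp] at h
  exact h

theorem swapBracket_antisymm [CharZero K] (f g : SwapRing K P) :
    swapBracket K P f g = -swapBracket K P g f := by
  refine Biderivation.antisymm _ _ (adjoin_pair K P) ?_ f g
  rintro _ ⟨a, rfl⟩ _ ⟨b, rfl⟩
  simp only [swapBracket_pair]
  rw [linkingNumber_antisymm (b.1 : UnitAddCircle)]
  rw [Rat.cast_neg, map_neg]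
  ring

variable {P}

/-- The determinant `Δ((x₁, …, xₘ), (y₁, …, yₘ)) = det (xᵢ yⱼ)`. -/
def swapDet {m : ℕ} (x y : Fin m → P) : SwapRing K P :=
  (Matrix.of fun i j => pair K (x i) (y j)).det

variable (P)

/-- The ideal `R_n(P)` generated by all determinants of size `n + 1`. -/
def rankIdeal (n : ℕ) : Ideal (SwapRing K P) :=
  Ideal.span {D | ∃ x y : Fin (n + 1) → P, D = swapDet K x y}

theorem swapBracket_preserves [CharZero K] (n : ℕ) : (swapBracket K P).Preserves (rankIdeal K P n) := by
  refine Biderivation.preserves_span _ _ _ (adjoin_pair K P) ?_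
  rintro _ ⟨x, y, rfl⟩ _ ⟨⟨a, b⟩, rfl⟩
  suffices h : swapBracket K P (pair K a b) (swapDet K x y) ∈ rankIdeal K P n by
    refine ⟨?_, h⟩
    rw [swapBracket_antisymm]
    exact neg_mem h
  have hmem : ∀ x y : Fin (n + 1) → P, swapDet K x y ∈ rankIdeal K P n :=
    fun x y => Ideal.subset_span ⟨x, y, rfl⟩
  set M : Matrix (Fin (n + 1)) (Fin (n + 1)) (SwapRing K P) :=
    Matrix.of fun i j => pair K (x i) (y j) with hM
  let F : P → SwapRing K P := fun t => algebraMap K _ (arcSide 0 a b t : K)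
  let N₁ : Matrix (Fin (n + 1)) (Fin (n + 1)) (SwapRing K P) :=
    fun i j => (F (y j) * pair K a (y j)) * pair K (x i) b
  let N₂ : Matrix (Fin (n + 1)) (Fin (n + 1)) (SwapRing K P) :=
    fun i j => (F (x i) * pair K (x i) b) * pair K a (y j)
  have hD : ∀ i j, swapBracket K P (pair K a b) (M i j) = N₁ i j - N₂ i j := by
    intro i j
    simp only [hM, Matrix.of_apply, swapBracket_pair, linkingNumber_eq_sub, N₁, N₂, F]
    rw [Rat.cast_sub, map_sub]
    ring
  have key : swapBracket K P (pair K a b) M.det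
      = ∑ j, (M.updateCol j fun i => N₁ i j).det - ∑ i, (M.updateRow i (N₂ i)).det := by
    rw [derivation_det, ← sum_updateCol_eq_sum_updateRow, ← Finset.sum_sub_distrib]
    refine Finset.sum_congr rfl fun j _ => ?_
    simp only [hD, ← Matrix.cramer_apply]
    have : (fun i => N₁ i j - N₂ i j) = (fun i => N₁ i j) - fun i => N₂ i j := rfl
    rw [this, map_sub, Pi.sub_apply]
  change swapBracket K P (pair K a b) M.det ∈ _
  rw [key]
  refine sub_mem (sum_mem fun j _ => ?_) (sum_mem fun i _ => ?_)
  · have h1 : (fun i => N₁ i j) = (F (y j) * pair K a (y j)) • fun i => pair K (x i) b := rfl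
    have h2 : (M.updateCol j fun i => pair K (x i) b)
        = Matrix.of fun i k => pair K (x i) (Function.update y j b k) := by
      ext i k
      by_cases hk : k = j
      · subst hk; simp
      · simp [hM, hk]
    rw [h1, Matrix.det_updateCol_smul, h2]
    exact Ideal.mul_mem_left _ _ (hmem x (Function.update y j b))
  · have h1 : N₂ i = (F (x i) * pair K (x i) b) • fun j => pair K a (y j) := rfl
    have h2 : (M.updateRow i fun j => pair K a (y j))
        = Matrix.of fun k j => pair K (Function.update x i a k) (y j) := by
      ext k j
      by_cases hk : k = i
      · subst hk; simp
      · simp [hM, hk]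
    rw [h1, Matrix.det_updateRow_smul, h2]
    exact Ideal.mul_mem_left _ _ (hmem (Function.update x i a) y)

/-- The rank `n` swapping ring `𝓩_n(P)`. -/
def RankRing (n : ℕ) := SwapRing K P ⧸ rankIdeal K P n

instance (n : ℕ) : CommRing (RankRing K P n) :=
  inferInstanceAs (CommRing (SwapRing K P ⧸ rankIdeal K P n))

instance (n : ℕ) : Algebra K (RankRing K P n) :=
  inferInstanceAs (Algebra K (SwapRing K P ⧸ rankIdeal K P n))

/-- The quotient map from the swapping ring to the rank `n` swapping ring. -/
def RankRing.mk (n : ℕ) : SwapRing K P →ₐ[K] RankRing K P n :=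
  Ideal.Quotient.mkₐ K (rankIdeal K P n)

theorem RankRing.mk_surjective (n : ℕ) : Function.Surjective (RankRing.mk K P n) :=
  Ideal.Quotient.mk_surjective

theorem RankRing.mk_eq_zero_iff (n : ℕ) (f : SwapRing K P) :
    RankRing.mk K P n f = 0 ↔ f ∈ rankIdeal K P n :=
  Ideal.Quotient.eq_zero_iff_mem

/-- The swapping bracket on `𝓩_n(P)`. -/
def rankBracket [CharZero K] (n : ℕ) : Biderivation K (RankRing K P n) :=
  (swapBracket K P).quotient (rankIdeal K P n) (swapBracket_preserves K P n)

theorem rankBracket_mk [CharZero K] (n : ℕ) (f g : SwapRing K P) :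
    rankBracket K P n (RankRing.mk K P n f) (RankRing.mk K P n g)
      = RankRing.mk K P n (swapBracket K P f g) :=
  Biderivation.quotient_mk _ _ _ f g

/-- The total fraction ring `𝓠_n(P)` of `𝓩_n(P)`. -/
abbrev RankFractionRing (n : ℕ) : Type _ := FractionRing (RankRing K P n)

/-- The swapping bracket on `𝓠_n(P)`. -/
def fractionBracket [CharZero K] (n : ℕ) : Biderivation K (RankFractionRing K P n) :=
  (rankBracket K P n).fraction

variable {P}

variable (P)

/-- The canonical map `𝓩(P) → 𝓩_n(P) → 𝓠_n(P)`. -/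
def toFraction (n : ℕ) : SwapRing K P →ₐ[K] RankFractionRing K P n :=
  (IsScalarTower.toAlgHom K (RankRing K P n) (RankFractionRing K P n)).comp (RankRing.mk K P n)

theorem fractionBracket_toFraction [CharZero K] (n : ℕ) (f g : SwapRing K P) :
    fractionBracket K P n (toFraction K P n f) (toFraction K P n g)
      = toFraction K P n (swapBracket K P f g) := by
  have h := Biderivation.fraction_algebraMap (rankBracket K P n) (RankRing.mk K P n f)
    (RankRing.mk K P n g)
  rw [rankBracket_mk] at h
  exact h

variable {P}

/-- The determinant `Δ((x₁, …, xₘ), (y₁, …, yₘ))` as an element of `𝓠_n(P)`. -/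
def rankDet (n : ℕ) {m : ℕ} (x y : Fin m → P) : RankFractionRing K P n :=
  toFraction K P n (swapDet K x y)

variable {K}

/-- The normalized bracket `[a, b] = {a, b} / (a · b)` in `𝓠_n(P)`. Here `Ring.inverse` is the
multiplicative inverse of a unit, so this is meaningful when `a` and `b` are units. -/
def normalizedBracket [CharZero K] {n : ℕ} (a b : RankFractionRing K P n) : RankFractionRing K P n :=
  fractionBracket K P n a b * Ring.inverse (a * b)

/-- The `n`-tuple `(x^m, y^l, z^p) = (x₁, …, xₘ, y₁, …, y_l, z₁, …, z_p)`, where the points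
`x₁, …, x_N` are stored as `x 0, …, x (N - 1)`, and likewise for `y` and `z`. -/
def tripleTuple {N n m l p : ℕ} (x y z : Fin N → P) (hm : m ≤ N) (hl : l ≤ N) (hp : p ≤ N)
    (h : m + l + p = n) : Fin n → P := fun i =>
  Fin.append (Fin.append (Fin.take m hm x) (Fin.take l hl y)) (Fin.take p hp z)
    (Fin.cast h.symm i)

end SwappingAlgebra

end Swapping

end

/-!
The scalar comes from a computation in the swapping ring `𝓩(P)` itself. Let `a` and `b` be the two
tuples of points taken from the `x`, `y`, `z`. In the prescribed cyclic order the linking number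
`𝓙(a_i v_j, b_k u_l)` does not depend on `j` and `l`, so that the bracket of `Δ(a, v)` and `Δ(b, u)`
is a sum over pairs `(i, k)` of `𝓙 • Δ(a, v) • Δ(b, u)` with `a_i` and `b_k` exchanged
(`swapBracket_swapDet`). If `a_i = b_k`, the exchange does nothing, and the linking number is `1/2`
for an `x` and `-1/2` for a `y` or a `z`. If `a_i ≠ b_k`, either a row is repeated or, thanks to the
hypothesis on `l, l', p, p'`, the linking number is zero. Hence the bracket is the announced scalar
times the product (`FlagOrder.swapBracket_swapDet_tripleTuple`).

The substance is that the determinants are units, i.e. that an `n × n` minor on distinct rows and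
distinct columns is not a zero divisor modulo the diagonal variables `X_{ii}` and the minors of size
`n + 1`. Only finitely many points matter. Consider the contraction `X_{ij} ↦ ∑ₐ x_{i,a} y_{j,a}`
to the coordinate ring of configurations of vectors and covectors in dimension `n`.

* Its kernel is generated by the minors of size `n + 1`
  (`mem_minorIdeal_of_contraction_eq_zero`): modulo these, every polynomial is a combination of
  monomials without antidiagonals of length `n + 1`, and the images of such monomials are linearly
  independent, as one sees by colouring their supports with `n` colours.
* It is pure (`exists_contraction_eq_of_mem`): over `ℚ`, the range of the contraction is stable
  under the adjoints, for the apolar inner product, of multiplication by the contracted variables,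
  so that orthogonal projection replaces a Reynolds operator. Arbitrary fields of characteristic
  zero follow by applying `ℚ`-linear functionals to coefficients.
* The contracted diagonal variables `∑ₐ x_{i,a} y_{i,a}` generate a prime ideal when `2 ≤ n`
  (`map_contraction_diagonalVarIdeal_isPrime`), by comparison with Laurent polynomials in the
  `x_{i,0}`.

An `n × n` minor contracts to `det (x_{a_i}) * det (y_{b_j})`, neither factor of which lies in this
prime ideal; by purity and the description of the kernel the minor is regular
(`mem_of_mul_det_mem`).
-/

noncomputable section

namespace Swapping

open MvPolynomial

/-! ### Determinantal ideals and the contraction map -/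

/-- The ideal of `R[X_{ij}]` generated by the diagonal variables. -/
def diagonalVarIdeal (R ι : Type*) [CommRing R] : Ideal (MvPolynomial (ι × ι) R) :=
  Ideal.span (Set.range fun i => X (i, i))

/-- The ideal of `R[X_{ij}]` generated by the `n × n` minors (repeated rows and columns and all
orderings are allowed). -/
def minorIdeal (R ι : Type*) [CommRing R] (n : ℕ) : Ideal (MvPolynomial (ι × ι) R) :=
  Ideal.span {D | ∃ a b : Fin n → ι, D = (Matrix.of fun i j => X (a i, b j)).det}

/-- The homomorphism `X_{ij} ↦ ∑ₐ x_{i,a} y_{j,a}` into the polynomial ring on the coordinates of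
vectors `x_i` and covectors `y_i` in dimension `n`: the variable `(i, inl a)` is `x_{i,a}` and the
variable `(i, inr a)` is `y_{i,a}`. -/
def contraction (R ι : Type*) [CommRing R] (n : ℕ) :
    MvPolynomial (ι × ι) R →ₐ[R] MvPolynomial (ι × (Fin n ⊕ Fin n)) R :=
  aeval fun p => ∑ a, X (p.1, Sum.inl a) * X (p.2, Sum.inr a)

theorem contraction_X (R ι : Type*) [CommRing R] (n : ℕ) (i j : ι) :
    contraction R ι n (X (i, j)) = ∑ a, X (i, Sum.inl a) * X (j, Sum.inr a) := by
  simp [contraction]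

/-- The matrix whose rows are the vectors `x_{a 0}, x_{a 1}, …`. -/
def vectorMatrix (R : Type*) {ι : Type*} [CommRing R] (n : ℕ) {m : ℕ} (a : Fin m → ι) :
    Matrix (Fin m) (Fin n) (MvPolynomial (ι × (Fin n ⊕ Fin n)) R) :=
  Matrix.of fun i c => X (a i, Sum.inl c)

/-- The matrix whose columns are the covectors `y_{b 0}, y_{b 1}, …`. -/
def covectorMatrix (R : Type*) {ι : Type*} [CommRing R] (n : ℕ) {m : ℕ} (b : Fin m → ι) :
    Matrix (Fin n) (Fin m) (MvPolynomial (ι × (Fin n ⊕ Fin n)) R) :=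
  Matrix.of fun c j => X (b j, Sum.inr c)

theorem contraction_det (R ι : Type*) [CommRing R] (n : ℕ) {m : ℕ} (a b : Fin m → ι) :
    contraction R ι n (Matrix.of fun i j => X (a i, b j)).det
      = (vectorMatrix R n a * covectorMatrix R n b).det := by
  rw [AlgHom.map_det]
  congr 1
  ext1 i j
  simp [contraction_X, Matrix.mul_apply, vectorMatrix, covectorMatrix]

/-! ### Antidiagonal chains -/

section Chains

variable {α : Type*} [LinearOrder α]

/-- The set `s` contains `n` positions running strictly downwards in the first coordinate and
strictly leftwards in the second one. -/
def HasAntidiagonal (n : ℕ) (s : Set (α × α)) : Prop :=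
  ∃ i j : Fin n → α, StrictMono i ∧ StrictAnti j ∧ ∀ k, (i k, j k) ∈ s

/-- A set without antidiagonals of length `n + 1` splits into `n` classes without antidiagonals of
length two: a position is coloured by the length of the longest antidiagonal that ends just before
it. -/
theorem exists_colouring (n : ℕ) (s : Set (α × α)) (h : ¬ HasAntidiagonal (n + 1) s) :
    ∃ c : α × α → ℕ, (∀ p ∈ s, c p < n) ∧
      ∀ p ∈ s, ∀ q ∈ s, c p = c q → ¬ (p.1 < q.1 ∧ q.2 < p.2) := by
  classical
  induction n generalizing s with
  | zero =>
    have hs : ∀ p, p ∉ s := fun p hp => h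
      ⟨fun _ => p.1, fun _ => p.2, fun a b hab => absurd hab (by omega),
        fun a b hab => absurd hab (by omega), fun _ => hp⟩
    exact ⟨fun _ => 0, fun p hp => absurd hp (hs p), fun p hp => absurd hp (hs p)⟩
  | succ n ih =>
    obtain ⟨c, hc, hc'⟩ := ih {p ∈ s | ∃ q ∈ s, q.1 < p.1 ∧ p.2 < q.2} (by
      rintro ⟨i, j, hi, hj, hij⟩
      obtain ⟨q, hq, hq1, hq2⟩ := (hij 0).2
      refine h ⟨Fin.cons q.1 i, Fin.cons q.2 j, ?_, ?_, ?_⟩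
      · refine Fin.strictMono_iff_lt_succ.mpr fun k => ?_
        induction k using Fin.cases with
        | zero => simpa using hq1
        | succ k => simpa [← Fin.succ_castSucc] using hi Fin.castSucc_lt_succ
      · refine Fin.strictAnti_iff_succ_lt.mpr fun k => ?_
        induction k using Fin.cases with
        | zero => simpa using hq2
        | succ k => simpa [← Fin.succ_castSucc] using hj Fin.castSucc_lt_succ
      · intro k
        induction k using Fin.cases with
        | zero => simpa using hq
        | succ k => simpa using (hij k).1)
    refine ⟨fun p => if ∃ q ∈ s, q.1 < p.1 ∧ p.2 < q.2 then c p + 1 else 0, ?_, ?_⟩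
    · intro p hp
      dsimp only
      split_ifs with hq
      · exact Nat.succ_lt_succ (hc p ⟨hp, hq⟩)
      · exact Nat.succ_pos n
    · intro p hp q hq hpq hlt
      dsimp only at hpq
      rw [if_pos (⟨p, hp, hlt⟩ : ∃ p ∈ s, p.1 < q.1 ∧ q.2 < p.2)] at hpq
      split_ifs at hpq with hp'
      exact hc' p ⟨hp, hp'⟩ q ⟨hq, p, hp, hlt⟩ (Nat.succ_injective hpq) hlt

end Chains

/-! ### Weights of monomials -/

section Weights

variable {N : ℕ}

/-- The mass of the exponent matrix `A` in the quadrant `i ≥ s`, `j ≥ t`. -/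
def quadrantMass (s t : ℕ) : (Fin N × Fin N →₀ ℕ) →+ ℕ :=
  Finsupp.weight fun p => if s ≤ p.1 ∧ t ≤ p.2 then 1 else 0

/-- The weight `∑ (i + 1) (j + 1) A i j` of the exponent matrix `A`. -/
def productWeight : (Fin N × Fin N →₀ ℕ) →+ ℕ :=
  Finsupp.weight fun p => ((p.1 : ℕ) + 1) * (p.2 + 1)

theorem weight_eq_sum {σ : Type*} [Fintype σ] (w : σ → ℕ) (A : σ →₀ ℕ) :
    Finsupp.weight w A = ∑ p, A p * w p := by
  rw [Finsupp.weight_apply, Finsupp.sum_fintype _ _ (by simp)]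
  rfl

theorem productWeight_eq_sum (A : Fin N × Fin N →₀ ℕ) :
    productWeight A
      = ∑ s ∈ Finset.range (N + 1), ∑ t ∈ Finset.range (N + 1), quadrantMass s t A := by
  have h : ∀ i : Fin N,
      ∑ s ∈ Finset.range (N + 1), (if s ≤ (i : ℕ) then 1 else 0) = (i : ℕ) + 1 := by
    intro i
    rw [← Finset.card_filter]
    have : (Finset.range (N + 1)).filter (fun s => s ≤ (i : ℕ)) = Finset.range (i + 1) := by
      ext s
      simp only [Finset.mem_filter, Finset.mem_range]
      omega
    rw [this, Finset.card_range]
  simp only [productWeight, quadrantMass, weight_eq_sum]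
  simp_rw [Finset.sum_comm (t := (Finset.univ : Finset (Fin N × Fin N)))]
  refine Finset.sum_congr rfl fun p _ => ?_
  simp_rw [← Finset.mul_sum]
  rw [← h p.1, ← h p.2, Finset.sum_mul_sum]
  congr 1
  refine Finset.sum_congr rfl fun s _ => Finset.sum_congr rfl fun t _ => ?_
  split_ifs <;> simp_all

/-- An exponent matrix is determined by its quadrant masses (inclusion-exclusion). -/
theorem eq_of_quadrantMass_eq {A B : Fin N × Fin N →₀ ℕ}
    (h : ∀ s t, quadrantMass s t A = quadrantMass s t B) : A = B := by
  have key : ∀ (A : Fin N × Fin N →₀ ℕ) (p : Fin N × Fin N),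
      quadrantMass p.1 p.2 A + quadrantMass (p.1 + 1) (p.2 + 1) A
        = quadrantMass (p.1 + 1) p.2 A + quadrantMass p.1 (p.2 + 1) A + A p := by
    intro A p
    have hA : A p = ∑ q, A q * (if q = p then 1 else 0) := by simp
    rw [hA]
    simp only [quadrantMass, weight_eq_sum, ← Finset.sum_add_distrib, ← mul_add]
    refine Finset.sum_congr rfl fun q _ => ?_
    congr 1
    have hq : q = p ↔ (q.1 : ℕ) = p.1 ∧ (q.2 : ℕ) = p.2 := by
      rw [Prod.ext_iff, Fin.ext_iff, Fin.ext_iff]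
    simp only [hq]
    split_ifs <;> omega
  ext p
  have h1 := key A p
  have h2 := key B p
  rw [h, h, h, h] at h1
  omega

theorem productWeight_le (A : Fin N × Fin N →₀ ℕ) :
    productWeight A ≤ (N + 1) * (N + 1) * A.degree := by
  rw [productWeight, weight_eq_sum, Finsupp.degree_eq_sum, Finset.mul_sum]
  refine Finset.sum_le_sum fun p _ => ?_
  rw [mul_comm]
  have h1 := p.1.2
  have h2 := p.2.2
  gcongr

/-- If every monomial of `f p` has weight at least `w p`, then every monomial of the image of
`X ^ A` under `X p ↦ f p` has weight at least that of `A`. -/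
theorem weight_le_of_mem_support_aeval {R σ τ : Type*} [CommRing R] {f : τ → MvPolynomial σ R}
    {w : τ → ℕ} {W : σ → ℕ} (h : ∀ p, ∀ m ∈ (f p).support, w p ≤ Finsupp.weight W m)
    (A : τ →₀ ℕ) : ∀ m ∈ (aeval f (monomial A (1 : R))).support,
      Finsupp.weight w A ≤ Finsupp.weight W m := by
  classical
  have hmul : ∀ (F G : MvPolynomial σ R) (a b : ℕ), (∀ m ∈ F.support, a ≤ Finsupp.weight W m) →
      (∀ m ∈ G.support, b ≤ Finsupp.weight W m) →
      ∀ m ∈ (F * G).support, a + b ≤ Finsupp.weight W m := by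
    intro F G a b hF hG m hm
    obtain ⟨m1, h1, m2, h2, rfl⟩ := Finset.mem_add.mp (support_mul F G hm)
    rw [map_add]
    exact add_le_add (hF m1 h1) (hG m2 h2)
  induction A using Finsupp.induction_linear with
  | zero => simp
  | add A B hA hB =>
    have : monomial (A + B) (1 : R) = monomial A 1 * monomial B 1 := by simp [monomial_mul]
    rw [this, map_mul, map_add]
    exact hmul _ _ _ _ hA hB
  | single p k =>
    rw [← X_pow_eq_monomial, map_pow, aeval_X]
    induction k with
    | zero => simp
    | succ k ih =>
      rw [pow_succ, Finsupp.single_add, map_add]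
      refine hmul _ _ _ _ ih fun m hm => ?_
      simpa [Finsupp.weight_single] using h p m hm

/-- Substituting polynomials with nonnegative coefficients into a monomial produces no
cancellation. -/
theorem coeff_aeval_monomial_pos {R σ τ : Type*} [Field R] [LinearOrder R] [IsStrictOrderedRing R]
    {f : τ → MvPolynomial σ R} (h : ∀ p m, 0 ≤ coeff m (f p)) (μ : τ → σ →₀ ℕ) (A : τ →₀ ℕ)
    (hμ : ∀ p ∈ A.support, 0 < coeff (μ p) (f p)) :
    0 < coeff (∑ p ∈ A.support, A p • μ p) (aeval f (monomial A (1 : R))) := by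
  classical
  have hmul0 : ∀ F G : MvPolynomial σ R, (∀ m, 0 ≤ coeff m F) → (∀ m, 0 ≤ coeff m G) →
      ∀ m, 0 ≤ coeff m (F * G) := by
    intro F G hF hG m
    rw [coeff_mul]
    exact Finset.sum_nonneg fun x _ => mul_nonneg (hF _) (hG _)
  have hmul : ∀ F G : MvPolynomial σ R, (∀ m, 0 ≤ coeff m F) → (∀ m, 0 ≤ coeff m G) →
      ∀ a b, 0 < coeff a F → 0 < coeff b G → 0 < coeff (a + b) (F * G) := by
    intro F G hF hG a b ha hb
    rw [coeff_mul]
    exact Finset.sum_pos' (fun x _ => mul_nonneg (hF _) (hG _))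
      ⟨(a, b), by simp, mul_pos ha hb⟩
  have hone0 : ∀ m, 0 ≤ coeff m (1 : MvPolynomial σ R) := by
    intro m
    rw [coeff_one]
    split_ifs <;> simp
  have hpow : ∀ p k, (∀ m, 0 ≤ coeff m (f p ^ k)) ∧
      (p ∈ A.support → 0 < coeff (k • μ p) (f p ^ k)) := by
    intro p k
    induction k with
    | zero => exact ⟨by simpa using hone0, by simp⟩
    | succ k ih =>
      rw [pow_succ, succ_nsmul]
      exact ⟨hmul0 _ _ ih.1 (h p), fun hp => hmul _ _ ih.1 (h p) _ _ (ih.2 hp) (hμ p hp)⟩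
  rw [aeval_monomial, map_one, one_mul, Finsupp.prod]
  have hs : ∀ s ⊆ A.support, (∀ m, 0 ≤ coeff m (∏ p ∈ s, f p ^ A p)) ∧
      0 < coeff (∑ p ∈ s, A p • μ p) (∏ p ∈ s, f p ^ A p) := by
    intro s
    induction s using Finset.induction_on with
    | empty => exact fun _ => ⟨by simpa using hone0, by simp⟩
    | insert a s ha ih =>
      intro hs
      rw [Finset.prod_insert ha, Finset.sum_insert ha]
      have hs' := ih fun p hp => hs (Finset.mem_insert_of_mem hp)
      exact ⟨hmul0 _ _ (hpow a _).1 hs'.1,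
        hmul _ _ (hpow a _).1 hs'.1 _ _ ((hpow a _).2 (hs (Finset.mem_insert_self a s))) hs'.2⟩
  exact (hs _ subset_rfl).2

end Weights

/-! ### The kernel of the contraction map -/

section Kernel

variable {N n : ℕ}

/-- An exponent matrix is `n`-good if its support contains no antidiagonal of length `n + 1`. -/
def IsGood (n : ℕ) (A : Fin N × Fin N →₀ ℕ) : Prop :=
  ¬ HasAntidiagonal (n + 1) (A.support : Set (Fin N × Fin N))

/-- The image of a good monomial `X ^ A` under the contraction contains a monomial `μ` that can only
occur in the image of `X ^ B` if the quadrant masses of `B` are at most those of `A`: colour the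
support of `A` by `n` colours without antidiagonals inside a colour, and expand each factor `X p`
by the summand given by its colour. In a quadrant, each colour class has as much mass as its row
and column sums, which can be read off from `μ`, permit. -/
theorem exists_leading_monomial (hn : n ≠ 0) {A : Fin N × Fin N →₀ ℕ} (hA : IsGood n A) :
    ∃ μ, 0 < coeff μ (contraction ℚ (Fin N) n (monomial A 1)) ∧
      ∀ B : Fin N × Fin N →₀ ℕ, μ ∈ (contraction ℚ (Fin N) n (monomial B 1)).support →
        ∀ s t, quadrantMass s t B ≤ quadrantMass s t A := by
  classical
  obtain ⟨c', hc1, hc2⟩ := exists_colouring n _ hA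
  let c : Fin N × Fin N → Fin n := fun p => ⟨c' p % n, Nat.mod_lt _ (Nat.pos_of_ne_zero hn)⟩
  have hc : ∀ p ∈ A.support, ∀ q ∈ A.support, c p = c q → ¬ (p.1 < q.1 ∧ q.2 < p.2) := by
    intro p hp q hq hpq
    refine hc2 p hp q hq ?_
    simpa [c, Nat.mod_eq_of_lt (hc1 p hp), Nat.mod_eq_of_lt (hc1 q hq)] using hpq
  let μ : Fin N × Fin N → (Fin N × (Fin n ⊕ Fin n)) →₀ ℕ := fun p =>
    Finsupp.single (p.1, Sum.inl (c p)) 1 + Finsupp.single (p.2, Sum.inr (c p)) 1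
  have hterm : ∀ (p : Fin N × Fin N) (a : Fin n),
      (X (p.1, Sum.inl a) * X (p.2, Sum.inr a) : MvPolynomial (Fin N × (Fin n ⊕ Fin n)) ℚ)
        = monomial (Finsupp.single (p.1, Sum.inl a) 1 + Finsupp.single (p.2, Sum.inr a) 1) 1 := by
    intro p a
    rw [X, X, monomial_mul, mul_one]
  have hnonneg : ∀ (p : Fin N × Fin N) (m : (Fin N × (Fin n ⊕ Fin n)) →₀ ℕ) (a : Fin n),
      0 ≤ coeff m (X (p.1, Sum.inl a) * X (p.2, Sum.inr a) :
        MvPolynomial (Fin N × (Fin n ⊕ Fin n)) ℚ) := by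
    intro p m a
    rw [hterm, coeff_monomial]
    split_ifs <;> simp
  refine ⟨∑ p ∈ A.support, A p • μ p, ?_, ?_⟩
  · refine coeff_aeval_monomial_pos (fun p m => ?_) μ A fun p _ => ?_
    · rw [coeff_sum]
      exact Finset.sum_nonneg fun a _ => hnonneg p m a
    · rw [coeff_sum]
      refine Finset.sum_pos' (fun a _ => hnonneg p _ a) ⟨c p, Finset.mem_univ _, ?_⟩
      rw [hterm, coeff_monomial, if_pos rfl]
      exact one_pos
  · intro B hB s t
    rw [contraction] at hB
    -- In the quadrant `i ≥ s`, `j ≥ t`, a colour is limited by its row sums if it has no mass at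
    -- `i ≥ s`, `j < t`, and by its column sums otherwise.
    let Q : Fin n → Prop := fun a => ∀ p ∈ A.support, c p = a → s ≤ (p.1 : ℕ) → t ≤ (p.2 : ℕ)
    let W : Fin N × (Fin n ⊕ Fin n) → ℕ := fun v =>
      Sum.elim (fun a => if Q a ∧ s ≤ (v.1 : ℕ) then 1 else 0)
        (fun a => if ¬ Q a ∧ t ≤ (v.1 : ℕ) then 1 else 0) v.2
    have hX : ∀ p : Fin N × Fin N, ∀ m ∈ (∑ a : Fin n, X (p.1, Sum.inl a) * X (p.2, Sum.inr a) :
        MvPolynomial (Fin N × (Fin n ⊕ Fin n)) ℚ).support,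
        (if s ≤ (p.1 : ℕ) ∧ t ≤ (p.2 : ℕ) then 1 else 0) ≤ Finsupp.weight W m := by
      intro p m hm
      have hm' := support_sum hm
      rw [Finset.mem_biUnion] at hm'
      obtain ⟨a, -, ha⟩ := hm'
      rw [hterm, support_monomial, if_neg one_ne_zero, Finset.mem_singleton] at ha
      rw [ha]
      simp only [map_add, Finsupp.weight_single, W, Sum.elim_inl, Sum.elim_inr, one_smul]
      by_cases hQ : Q a <;> by_cases hs : s ≤ (p.1 : ℕ) <;> by_cases ht : t ≤ (p.2 : ℕ) <;>
        simp [hQ, hs, ht]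
    have hW := weight_le_of_mem_support_aeval hX B _ hB
    refine hW.trans (le_of_eq ?_)
    rw [map_sum, quadrantMass, Finsupp.weight_apply, Finsupp.sum]
    refine Finset.sum_congr rfl fun p hp => ?_
    rw [map_nsmul]
    congr 1
    simp only [μ, map_add, Finsupp.weight_single, W, Sum.elim_inl, Sum.elim_inr, one_smul]
    by_cases hQ : Q (c p)
    · have := hQ p hp rfl
      by_cases hs : s ≤ (p.1 : ℕ) <;> simp [hQ, hs, this]
    · have hp' : t ≤ (p.2 : ℕ) → s ≤ (p.1 : ℕ) := by
        intro ht
        simp only [Q, not_forall] at hQ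
        obtain ⟨q, hq, hqc, hqs, hqt⟩ := hQ
        have := hc p hp q hq hqc.symm
        rw [Fin.lt_def, Fin.lt_def] at this
        omega
      by_cases ht : t ≤ (p.2 : ℕ) <;> simp [hQ, ht, hp']

/-- The contraction is injective on combinations of good monomials: the leading monomial of the
lightest good monomial that occurs cannot be cancelled by the others. -/
theorem eq_zero_of_contraction_eq_zero (hn : n ≠ 0) {g : MvPolynomial (Fin N × Fin N) ℚ}
    (hg : ∀ A ∈ g.support, IsGood n A) (h : contraction ℚ (Fin N) n g = 0) : g = 0 := by
  classical
  by_contra hne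
  obtain ⟨A, hA, hmin⟩ := Finset.exists_min_image g.support (productWeight (N := N))
    (support_nonempty.mpr hne)
  obtain ⟨μ, hμ, hμ'⟩ := exists_leading_monomial hn (hg A hA)
  have hexp : contraction ℚ (Fin N) n g
      = ∑ B ∈ g.support, C (coeff B g) * contraction ℚ (Fin N) n (monomial B 1) := by
    conv_lhs => rw [g.as_sum, map_sum]
    refine Finset.sum_congr rfl fun B _ => ?_
    rw [← mul_one (coeff B g), ← C_mul_monomial, map_mul, ← algebraMap_eq, AlgHom.commutes,
      mul_one, algebraMap_eq]
  have hcoeff := congrArg (coeff μ) (hexp.symm.trans h)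
  rw [coeff_sum, Finset.sum_eq_single A] at hcoeff
  · rw [coeff_C_mul, coeff_zero, mul_eq_zero] at hcoeff
    exact hcoeff.elim (mem_support_iff.mp hA) hμ.ne'
  · intro B hB hBA
    rw [coeff_C_mul, mul_eq_zero]
    refine Or.inr (not_not.mp fun hne => hBA ?_)
    have hle := hμ' B (mem_support_iff.mpr hne)
    have hmin' := hmin B hB
    rw [productWeight_eq_sum, productWeight_eq_sum] at hmin'
    have heq : ∀ s < N + 1, ∀ t < N + 1, quadrantMass s t B = quadrantMass s t A := by
      intro s hs t ht
      have h1 := (Finset.sum_eq_sum_iff_of_le fun s _ =>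
        Finset.sum_le_sum fun t (_ : t ∈ Finset.range (N + 1)) => hle s t).mp
        (le_antisymm (Finset.sum_le_sum fun s _ => Finset.sum_le_sum fun t _ => hle s t) hmin')
        s (Finset.mem_range.mpr hs)
      exact (Finset.sum_eq_sum_iff_of_le fun t _ => hle s t).mp h1 t (Finset.mem_range.mpr ht)
    refine eq_of_quadrantMass_eq fun s t => ?_
    by_cases hst : s < N + 1 ∧ t < N + 1
    · exact heq s hst.1 t hst.2
    · have h0 : ∀ D : Fin N × Fin N →₀ ℕ, quadrantMass s t D = 0 := by
        intro D
        rw [quadrantMass, weight_eq_sum]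
        refine Finset.sum_eq_zero fun p _ => ?_
        rw [if_neg (by have := p.1.2; have := p.2.2; omega), mul_zero]
      rw [h0, h0]
  · exact fun hA' => absurd hA hA'

/-- Rearrangement inequality: an antidiagonal is the lightest among the permutation patterns on the
same rows and columns. -/
theorem productWeight_antidiagonal_lt {k : ℕ} {i j : Fin k → Fin N} (hi : StrictMono i)
    (hj : StrictAnti j) {σ : Equiv.Perm (Fin k)} (hσ : σ ≠ 1) :
    productWeight (∑ a, Finsupp.single (i a, j a) 1)
      < productWeight (∑ a, Finsupp.single (i a, j (σ a)) 1) := by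
  simp only [map_sum, productWeight, Finsupp.weight_single, one_smul]
  have hanti : Antivary (fun a => ((i a : Fin N) : ℕ) + 1) (fun a => ((j a : Fin N) : ℕ) + 1) := by
    intro a b hab
    have : j a < j b := by simpa using hab
    have := hi (hj.lt_iff_gt.mp this)
    have := Fin.lt_def.mp this
    dsimp only
    omega
  refine (hanti.sum_mul_lt_sum_mul_comp_perm_iff (σ := σ)).mpr fun h => hσ ?_
  have hmono : StrictMono σ := by
    refine Monotone.strictMono_of_injective (fun a b hab => ?_) σ.injective
    by_contra! hlt
    have h1 := h (i := a) (j := b) (by simpa using hj hlt)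
    have h2 : i b ≤ i a := by simpa using h1
    have : a = b := le_antisymm hab (hi.le_iff_le.mp h2)
    exact absurd hlt (by simp [this])
  ext a
  have : ∀ a, σ a = a := fun a => congrFun (StrictMono.range_inj hmono strictMono_id |>.mp (by
    simp [σ.surjective.range_eq])) a
  simp [this a]

/-- Straightening: an antidiagonal of length `n + 1` may be replaced, modulo a minor, by heavier
patterns of the same degree, and the weight is bounded in each degree. -/
theorem exists_good_sub_mem (R : Type*) [CommRing R] (n : ℕ) (f : MvPolynomial (Fin N × Fin N) R) :
    ∃ g, f - g ∈ minorIdeal R (Fin N) (n + 1) ∧ ∀ A ∈ g.support, IsGood n A := by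
  classical
  let V : Submodule R (MvPolynomial (Fin N × Fin N) R) :=
    (minorIdeal R (Fin N) (n + 1)).restrictScalars R ⊔ restrictSupport R {A | IsGood n A}
  suffices h : ∀ d A, (N + 1) * (N + 1) * A.degree - productWeight A ≤ d → monomial A 1 ∈ V by
    have hf : f ∈ V := by
      rw [f.as_sum]
      refine sum_mem fun A _ => ?_
      rw [← mul_one (coeff A f), ← smul_eq_mul, ← smul_monomial]
      exact Submodule.smul_mem _ _ (h _ A le_rfl)
    obtain ⟨e, he, g, hg, rfl⟩ := Submodule.mem_sup.mp hf
    refine ⟨g, by simpa using he, fun A hA => ?_⟩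
    exact hg hA
  intro d
  induction d using Nat.strong_induction_on with
  | _ d ih =>
  intro A hA
  by_cases hgood : IsGood n A
  · refine Submodule.mem_sup_right ?_
    rw [mem_restrictSupport_iff]
    exact (Finset.coe_subset.mpr support_monomial_subset).trans (by simpa using hgood)
  · obtain ⟨i, j, hi, hj, hij⟩ := not_not.mp hgood
    let E : Equiv.Perm (Fin (n + 1)) → (Fin N × Fin N →₀ ℕ) := fun σ =>
      ∑ a, Finsupp.single (i a, j (σ a)) 1
    have hle : E 1 ≤ A := by
      intro p
      simp only [E, Finsupp.finsetSum_apply, Equiv.Perm.one_apply]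
      by_cases hp : ∃ a, (i a, j a) = p
      · obtain ⟨a, rfl⟩ := hp
        rw [Finset.sum_eq_single a]
        · simpa [Nat.one_le_iff_ne_zero] using hij a
        · intro b _ hb
          rw [Finsupp.single_apply, if_neg]
          exact fun h => hb (hi.injective (Prod.ext_iff.mp h).1)
        · simp
      · rw [Finset.sum_eq_zero]
        · exact Nat.zero_le _
        · intro b _
          rw [Finsupp.single_apply, if_neg fun h => hp ⟨b, h⟩]
    obtain ⟨B, rfl⟩ := exists_add_of_le hle
    have hmon : ∀ σ : Equiv.Perm (Fin (n + 1)),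
        (∏ a, X (i a, j (σ a)) : MvPolynomial (Fin N × Fin N) R) = monomial (E σ) 1 := by
      intro σ
      exact (monomial_sum_one _ _).symm
    have hdet : (monomial (E 1) 1 : MvPolynomial (Fin N × Fin N) R)
        = (Matrix.of fun a b => X (i a, j b)).det
          - ∑ σ ∈ Finset.univ.erase 1, Equiv.Perm.sign σ • monomial (E σ) (1 : R) := by
      rw [← Matrix.det_transpose, Matrix.det_apply, ← Finset.add_sum_erase _ _ (Finset.mem_univ 1)]
      simp only [Matrix.transpose_apply, Matrix.of_apply, hmon]
      simp
    have hsplit : ∀ σ, (monomial (E σ + B) 1 : MvPolynomial (Fin N × Fin N) R)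
        = monomial B 1 * monomial (E σ) 1 := by
      intro σ
      rw [monomial_mul, mul_one, add_comm]
    rw [hsplit, hdet, mul_sub]
    refine sub_mem (Submodule.mem_sup_left ?_) ?_
    · exact Ideal.mul_mem_left _ _ (Ideal.subset_span ⟨i, j, rfl⟩)
    · rw [Finset.mul_sum]
      refine sum_mem fun σ hσ => ?_
      rw [mul_smul_comm, ← hsplit, Units.smul_def]
      refine zsmul_mem ?_ _
      have hlt : productWeight (E 1 + B) < productWeight (E σ + B) := by
        rw [map_add, map_add]
        exact Nat.add_lt_add_right
          (productWeight_antidiagonal_lt hi hj (Finset.ne_of_mem_erase hσ)) _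
      have hdeg : (E σ + B).degree = (E 1 + B).degree := by
        simp [E, map_add, map_sum]
      have hbound := productWeight_le (E σ + B)
      refine ih _ ?_ _ le_rfl
      rw [hdeg] at hbound ⊢
      omega

theorem det_mul_eq_zero_of_width_lt {R : Type*} [CommRing R] {n : ℕ}
    (A : Matrix (Fin (n + 1)) (Fin n) R) (B : Matrix (Fin n) (Fin (n + 1)) R) :
    (A * B).det = 0 := by
  let A' : Matrix (Fin (n + 1)) (Fin (n + 1)) R :=
    Matrix.of fun i => Fin.snoc (α := fun _ => R) (A i) 0
  let B' : Matrix (Fin (n + 1)) (Fin (n + 1)) R :=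
    Matrix.of fun c j => Fin.snoc (α := fun _ => R) (fun c => B c j) 0 c
  have h : A * B = A' * B' := by
    ext i j
    rw [Matrix.mul_apply, Matrix.mul_apply, Fin.sum_univ_castSucc]
    simp [A', B']
  rw [h, Matrix.det_mul, Matrix.det_eq_zero_of_column_eq_zero (Fin.last n) (by simp [A']), zero_mul]

/-- The kernel of the contraction is generated by the minors of size `n + 1`. -/
theorem mem_minorIdeal_of_contraction_eq_zero (hn : n ≠ 0) {f : MvPolynomial (Fin N × Fin N) ℚ}
    (hf : contraction ℚ (Fin N) n f = 0) : f ∈ minorIdeal ℚ (Fin N) (n + 1) := by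
  obtain ⟨g, hg, hgood⟩ := exists_good_sub_mem ℚ n f
  have hker : minorIdeal ℚ (Fin N) (n + 1) ≤ RingHom.ker (contraction ℚ (Fin N) n) := by
    refine Ideal.span_le.mpr ?_
    rintro _ ⟨a, b, rfl⟩
    rw [SetLike.mem_coe, RingHom.mem_ker, contraction_det]
    exact det_mul_eq_zero_of_width_lt _ _
  have h0 := RingHom.mem_ker.mp (hker hg)
  rw [map_sub, hf, zero_sub, neg_eq_zero] at h0
  rwa [eq_zero_of_contraction_eq_zero hn hgood h0, sub_zero] at hg

end Kernel

/-! ### The apolar inner product -/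

section Fischer

variable {σ : Type*}

/-- The apolar (Fischer) inner product on rational polynomials: distinct monomials are orthogonal
and `⟨X ^ m, X ^ m⟩ = ∏ (m i)!`. -/
def apolarForm : MvPolynomial σ ℚ →ₗ[ℚ] MvPolynomial σ ℚ →ₗ[ℚ] ℚ :=
  (basisMonomials σ ℚ).constr ℚ fun m => (m.prod fun _ k => (k.factorial : ℚ)) • lcoeff ℚ m

theorem apolarForm_monomial (m : σ →₀ ℕ) (a : ℚ) (g : MvPolynomial σ ℚ) :
    apolarForm (monomial m a) g = a * ((m.prod fun _ k => (k.factorial : ℚ)) * coeff m g) := by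
  have h : monomial m a = a • basisMonomials σ ℚ m := by simp [smul_monomial]
  rw [h, map_smul, apolarForm, Module.Basis.constr_basis]
  simp

theorem prod_factorial_add_single (m : σ →₀ ℕ) (i : σ) :
    ((m + Finsupp.single i 1).prod fun _ k => (k.factorial : ℚ))
      = (m i + 1) * m.prod fun _ k => (k.factorial : ℚ) := by
  classical
  have h : ∀ m' : σ →₀ ℕ, m'.support ⊆ insert i m.support →
      (m'.prod fun _ k => (k.factorial : ℚ)) = ∏ j ∈ insert i m.support, ((m' j).factorial : ℚ) :=
    fun m' hm' => Finsupp.prod_of_support_subset _ hm' _ (by simp)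
  rw [h m (Finset.subset_insert _ _), h (m + Finsupp.single i 1) (by
    intro j hj
    by_cases hij : j = i
    · simp [hij]
    · simpa [hij, Finsupp.single_apply, Ne.symm hij] using hj)]
  rw [← Finset.mul_prod_erase _ _ (Finset.mem_insert_self i _),
    ← Finset.mul_prod_erase (insert i m.support) (fun j => ((m j).factorial : ℚ))
      (Finset.mem_insert_self i _), ← mul_assoc]
  congr 1
  · simp [Nat.factorial_succ]
  · refine Finset.prod_congr rfl fun j hj => ?_
    simp [(Finset.ne_of_mem_erase hj).symm]

/-- Multiplication by a variable is adjoint to the partial derivative. -/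
theorem apolarForm_X_mul (i : σ) (f g : MvPolynomial σ ℚ) :
    apolarForm (X i * f) g = apolarForm f (pderiv i g) := by
  induction f using MvPolynomial.induction_on' with
  | monomial m a =>
    rw [X, monomial_mul, one_mul, add_comm, apolarForm_monomial, apolarForm_monomial, coeff_pderiv,
      prod_factorial_add_single]
    ring
  | add f f' hf hf' =>
    rw [mul_add, map_add, map_add, LinearMap.add_apply, LinearMap.add_apply, hf, hf']

theorem eq_zero_of_apolarForm_self (f : MvPolynomial σ ℚ) (h : apolarForm f f = 0) : f = 0 := by
  have hf : apolarForm f f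
      = ∑ m ∈ f.support, coeff m f * ((m.prod fun _ k => (k.factorial : ℚ)) * coeff m f) := by
    conv_lhs => enter [1, 2]; rw [f.as_sum]
    rw [map_sum, LinearMap.sum_apply]
    exact Finset.sum_congr rfl fun m _ => apolarForm_monomial _ _ _
  have hfac : ∀ m : σ →₀ ℕ, 0 < m.prod fun _ k => (k.factorial : ℚ) := fun m =>
    Finset.prod_pos fun i _ => by positivity
  rw [hf, Finset.sum_eq_zero_iff_of_nonneg fun m _ => by
    have := hfac m
    nlinarith [mul_nonneg this.le (mul_self_nonneg (coeff m f))]] at h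
  ext m
  by_contra hm
  rw [coeff_zero] at hm
  have := h m (mem_support_iff.mpr hm)
  simp [hm, (hfac m).ne'] at this

/-- Orthogonal projection to a finite-dimensional subspace. -/
theorem exists_orthogonal_decomposition (W : Submodule ℚ (MvPolynomial σ ℚ)) [Module.Finite ℚ W]
    (v : MvPolynomial σ ℚ) : ∃ w ∈ W, ∀ u ∈ W, apolarForm u (v - w) = 0 := by
  let T : W →ₗ[ℚ] Module.Dual ℚ W := (apolarForm.compl₁₂ W.subtype W.subtype).flip
  have hT : Function.Injective T := by
    refine (injective_iff_map_eq_zero T).mpr fun w hw => ?_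
    have := LinearMap.congr_fun hw w
    exact Subtype.ext (eq_zero_of_apolarForm_self _ this)
  have hT' : Function.Surjective T :=
    (LinearMap.injective_iff_surjective_of_finrank_eq_finrank
      (Subspace.dual_finrank_eq).symm).mp hT
  obtain ⟨w, hw⟩ := hT' ((apolarForm.flip v).comp W.subtype)
  refine ⟨w, w.2, fun u hu => ?_⟩
  have := LinearMap.congr_fun hw ⟨u, hu⟩
  rw [map_sub, sub_eq_zero]
  exact this.symm

/-- The polynomials all of whose monomials have degree less than `k`. -/
abbrev degreeLT (σ : Type*) (k : ℕ) : Submodule ℚ (MvPolynomial σ ℚ) :=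
  restrictSupport ℚ {m | m.degree < k}

theorem finite_degreeLT [Finite σ] (k : ℕ) : Module.Finite ℚ (degreeLT σ k) := by
  have : Finite {m : σ →₀ ℕ | m.degree < k} :=
    (Finsupp.finite_of_degree_le (σ := σ) k).subset fun m hm =>
      le_of_lt (Set.mem_ofPred_eq ▸ hm)
  exact Module.Finite.of_basis (basisRestrictSupport ℚ _)

theorem mem_degreeLT {k : ℕ} {f : MvPolynomial σ ℚ} :
    f ∈ degreeLT σ k ↔ ∀ m, coeff m f ≠ 0 → m.degree < k := by
  rw [degreeLT, mem_restrictSupport_iff]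
  exact ⟨fun h m hm => h (mem_support_iff.mpr hm), fun h m hm => h m (mem_support_iff.mp hm)⟩

theorem pderiv_mem_degreeLT {k : ℕ} {f : MvPolynomial σ ℚ} (i : σ) (hf : f ∈ degreeLT σ (k + 1)) :
    pderiv i f ∈ degreeLT σ k := by
  rw [mem_degreeLT] at hf ⊢
  intro m hm
  rw [coeff_pderiv] at hm
  have := hf _ (left_ne_zero_of_mul hm)
  simpa using this

theorem X_mul_mem_degreeLT {k : ℕ} {f : MvPolynomial σ ℚ} (i : σ) (hf : f ∈ degreeLT σ k) :
    X i * f ∈ degreeLT σ (k + 1) := by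
  classical
  rw [mem_degreeLT] at hf ⊢
  intro m hm
  rw [coeff_X_mul'] at hm
  split_ifs at hm with hi
  · have := hf _ hm
    have hle : Finsupp.single i 1 ≤ m := by
      simpa [Nat.one_le_iff_ne_zero] using hi
    rw [← tsub_add_cancel_of_le hle, map_add, Finsupp.degree_single]
    omega
  · exact absurd rfl hm

theorem X_mul_pderiv_mem_degreeLT {k : ℕ} {f : MvPolynomial σ ℚ} (i j : σ) (hf : f ∈ degreeLT σ k) :
    X i * pderiv j f ∈ degreeLT σ k := by
  cases k with
  | zero =>
    have : f = 0 := by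
      ext m
      by_contra hm
      exact absurd (mem_degreeLT.mp hf m hm) (Nat.not_lt_zero _)
    simp [this]
  | succ k => exact X_mul_mem_degreeLT i (pderiv_mem_degreeLT j hf)

end Fischer

/-! ### Purity of the contraction map -/

section Purity

variable {ι : Type*} {n : ℕ}

theorem pderiv_inr_contraction [Fintype ι] [DecidableEq ι] (j : ι) (a : Fin n)
    (b : MvPolynomial (ι × ι) ℚ) :
    pderiv (j, Sum.inr a) (contraction ℚ ι n b)
      = ∑ r, X (r, Sum.inl a) * contraction ℚ ι n (pderiv (r, j) b) := by
  have hX : ∀ p : ι × ι, pderiv (j, Sum.inr a) (contraction ℚ ι n (X p))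
      = ∑ r, X (r, Sum.inl a) * contraction ℚ ι n (pderiv (r, j) (X p)) := by
    rintro ⟨r, c⟩
    by_cases hc : c = j
    · subst hc
      simp [contraction_X, Derivation.leibniz, pderiv_X, Pi.single_apply, Prod.ext_iff, apply_ite]
    · simp [contraction_X, Derivation.leibniz, pderiv_X, Prod.ext_iff, hc]
  induction b using MvPolynomial.induction_on with
  | C c => simp [contraction]
  | add f g hf hg => simp only [map_add, hf, hg, mul_add, Finset.sum_add_distrib]
  | mul_X f p hf =>
    rw [map_mul, Derivation.leibniz, hf, hX, smul_eq_mul, smul_eq_mul, Finset.mul_sum,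
      Finset.mul_sum, ← Finset.sum_add_distrib]
    refine Finset.sum_congr rfl fun r _ => ?_
    rw [Derivation.leibniz, map_add, smul_eq_mul, smul_eq_mul, map_mul, map_mul]
    ring

theorem pderiv_inl_contraction [Fintype ι] [DecidableEq ι] (i : ι) (a : Fin n)
    (b : MvPolynomial (ι × ι) ℚ) :
    pderiv (i, Sum.inl a) (contraction ℚ ι n b)
      = ∑ c, X (c, Sum.inr a) * contraction ℚ ι n (pderiv (i, c) b) := by
  have hX : ∀ p : ι × ι, pderiv (i, Sum.inl a) (contraction ℚ ι n (X p))
      = ∑ c, X (c, Sum.inr a) * contraction ℚ ι n (pderiv (i, c) (X p)) := by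
    rintro ⟨r, c⟩
    by_cases hr : r = i
    · subst hr
      simp [contraction_X, Derivation.leibniz, pderiv_X, Pi.single_apply, Prod.ext_iff, apply_ite]
    · simp [contraction_X, Derivation.leibniz, pderiv_X, Prod.ext_iff, hr]
  induction b using MvPolynomial.induction_on with
  | C c => simp [contraction]
  | add f g hf hg => simp only [map_add, hf, hg, mul_add, Finset.sum_add_distrib]
  | mul_X f p hf =>
    rw [map_mul, Derivation.leibniz, hf, hX, smul_eq_mul, smul_eq_mul, Finset.mul_sum,
      Finset.mul_sum, ← Finset.sum_add_distrib]
    refine Finset.sum_congr rfl fun r _ => ?_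
    rw [Derivation.leibniz, map_add, smul_eq_mul, smul_eq_mul, map_mul, map_mul]
    ring

/-- The operator `∑ₐ ∂²/∂x_{i,a}∂y_{j,a}`, adjoint to multiplication by the contraction of
`X_{ij}`. -/
def contractionAdjoint (i j : ι) (f : MvPolynomial (ι × (Fin n ⊕ Fin n)) ℚ) :
    MvPolynomial (ι × (Fin n ⊕ Fin n)) ℚ :=
  ∑ a, pderiv (i, Sum.inl a) (pderiv (j, Sum.inr a) f)

theorem apolarForm_contraction_X_mul (i j : ι) (f g : MvPolynomial (ι × (Fin n ⊕ Fin n)) ℚ) :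
    apolarForm (contraction ℚ ι n (X (i, j)) * f) g = apolarForm f (contractionAdjoint i j g) := by
  rw [contraction_X, Finset.sum_mul, map_sum, LinearMap.sum_apply, contractionAdjoint, map_sum]
  refine Finset.sum_congr rfl fun a _ => ?_
  rw [mul_comm (X _), mul_assoc, apolarForm_X_mul, apolarForm_X_mul]

/-- The range of the contraction is stable under the adjoints of the multiplications by its own
elements; this is what makes the orthogonal projection onto the range linear over it. -/
theorem contractionAdjoint_contraction [Fintype ι] [DecidableEq ι] (i j : ι)
    (b : MvPolynomial (ι × ι) ℚ) :
    contractionAdjoint i j (contraction ℚ ι n b)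
      = contraction ℚ ι n (n • pderiv (i, j) b
          + ∑ r, ∑ c, X (r, c) * pderiv (i, c) (pderiv (r, j) b)) := by
  have h : ∀ a : Fin n, pderiv (i, Sum.inl a) (pderiv (j, Sum.inr a) (contraction ℚ ι n b))
      = contraction ℚ ι n (pderiv (i, j) b) + ∑ r, ∑ c, X (r, Sum.inl a) * X (c, Sum.inr a)
          * contraction ℚ ι n (pderiv (i, c) (pderiv (r, j) b)) := by
    intro a
    rw [pderiv_inr_contraction, map_sum]
    simp only [Derivation.leibniz, pderiv_inl_contraction, Finset.sum_add_distrib, smul_eq_mul]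
    rw [add_comm]
    congr 1
    · rw [Finset.sum_eq_single i]
      · simp
      · intro r _ hr
        rw [pderiv_X_of_ne (by simpa using hr), mul_zero]
      · simp
    · refine Finset.sum_congr rfl fun r _ => ?_
      rw [Finset.mul_sum]
      exact Finset.sum_congr rfl fun c _ => by ring
  simp only [contractionAdjoint, h, Finset.sum_add_distrib, map_add, map_sum, map_nsmul, map_mul,
    contraction_X, Finset.sum_mul]
  congr 1
  · simp
  · rw [Finset.sum_comm]
    refine Finset.sum_congr rfl fun r _ => ?_
    rw [Finset.sum_comm]

/-- If the contraction of `b` lies in the ideal generated by the contractions of the diagonal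
variables, then it is already the contraction of an element of the diagonal ideal. The component
of `contraction b` orthogonal to the contractions of the diagonal ideal is killed by the adjoints
of the generators, hence is orthogonal to itself. -/
theorem exists_contraction_eq_of_mem [Finite ι] {b : MvPolynomial (ι × ι) ℚ}
    (hb : contraction ℚ ι n b ∈ (diagonalVarIdeal ℚ ι).map (contraction ℚ ι n)) :
    ∃ b' ∈ diagonalVarIdeal ℚ ι, contraction ℚ ι n b = contraction ℚ ι n b' := by
  classical
  have := Fintype.ofFinite ι
  obtain ⟨d, hd⟩ : ∃ d, b ∈ degreeLT (ι × ι) (d + 1) := by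
    refine ⟨b.support.sup Finsupp.degree, mem_degreeLT.mpr fun m hm => ?_⟩
    exact Nat.lt_succ_of_le (Finset.le_sup (f := Finsupp.degree) (mem_support_iff.mpr hm))
  have hfin := finite_degreeLT (σ := ι × ι) (d + 1)
  let W₀ : Submodule ℚ (MvPolynomial (ι × ι) ℚ) :=
    degreeLT (ι × ι) (d + 1) ⊓ (diagonalVarIdeal ℚ ι).restrictScalars ℚ
  have : Module.Finite ℚ W₀ := Submodule.finiteDimensional_inf_left _ _
  obtain ⟨_, ⟨b', ⟨hb'd, hb'⟩, rfl⟩, horth⟩ := exists_orthogonal_decomposition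
    (W₀.map (contraction ℚ ι n).toLinearMap) (contraction ℚ ι n b)
  have hb'' : b' ∈ diagonalVarIdeal ℚ ι := hb'
  refine ⟨b', hb'', ?_⟩
  rw [← sub_eq_zero]
  refine eq_zero_of_apolarForm_self _ ?_
  have hkill : ∀ i, contractionAdjoint i i (contraction ℚ ι n (b - b')) = 0 := by
    intro i
    have hsub : b - b' ∈ degreeLT (ι × ι) (d + 1) := sub_mem hd hb'd
    have hp : ∀ p, pderiv p (b - b') ∈ degreeLT (ι × ι) d := fun p => pderiv_mem_degreeLT p hsub
    have hh : n • pderiv (i, i) (b - b') + ∑ r, ∑ c, X (r, c) *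
        pderiv (i, c) (pderiv (r, i) (b - b')) ∈ degreeLT (ι × ι) d :=
      add_mem (nsmul_mem (hp _) _) (sum_mem fun r _ => sum_mem fun c _ =>
        X_mul_pderiv_mem_degreeLT _ _ (hp _))
    rw [contractionAdjoint_contraction]
    have hadj := contractionAdjoint_contraction (n := n) i i (b - b')
    generalize n • pderiv (i, i) (b - b') + ∑ r, ∑ c, X (r, c) *
        pderiv (i, c) (pderiv (r, i) (b - b')) = g at hh hadj ⊢
    have hW : X (i, i) * g ∈ W₀ := ⟨X_mul_mem_degreeLT _ hh,
      Ideal.mul_mem_right g (diagonalVarIdeal ℚ ι) (Ideal.subset_span ⟨i, rfl⟩)⟩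
    have h0 := horth _ (Submodule.mem_map_of_mem hW)
    rw [AlgHom.toLinearMap_apply, AlgHom.toLinearMap_apply, ← map_sub, map_mul,
      apolarForm_contraction_X_mul, hadj] at h0
    exact eq_zero_of_apolarForm_self _ h0
  have hmem : contraction ℚ ι n (b - b') ∈ (diagonalVarIdeal ℚ ι).map (contraction ℚ ι n) := by
    rw [map_sub]
    exact sub_mem hb (Ideal.mem_map_of_mem _ hb'')
  rw [← map_sub]
  rw [diagonalVarIdeal, Ideal.map_span, ← Set.range_comp] at hmem
  generalize contraction ℚ ι n (b - b') = w at hkill hmem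
  suffices h : ∀ f ∈ Ideal.span (Set.range ((contraction ℚ ι n) ∘ fun i => X (i, i))),
      ∀ c, apolarForm (f * c) w = 0 by simpa using h w hmem 1
  intro f hf
  induction hf using Submodule.span_induction with
  | mem f hf =>
    obtain ⟨i, rfl⟩ := hf
    intro c
    rw [Function.comp_apply, apolarForm_contraction_X_mul, hkill, map_zero]
  | zero => simp
  | add f g _ _ hf hg =>
    intro c
    rw [add_mul, map_add, LinearMap.add_apply, hf, hg, add_zero]
  | smul a f _ ih =>
    intro c
    rw [smul_eq_mul, mul_comm a, mul_assoc]
    exact ih (a * c)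

end Purity

/-! ### Extension of scalars from the rationals -/

section BaseChange

variable {K σ : Type*} [Field K] [CharZero K]

/-- Apply a `ℚ`-linear functional on `K` to the coefficients of a polynomial. -/
def coeffwise (l : K →ₗ[ℚ] ℚ) : MvPolynomial σ K →+ MvPolynomial σ ℚ where
  toFun f := ∑ m ∈ f.support, monomial m (l (coeff m f))
  map_zero' := by simp
  map_add' f g := by
    classical
    have h : ∀ f : MvPolynomial σ K, ∀ m,
        coeff m (∑ m ∈ f.support, monomial m (l (coeff m f))) = l (coeff m f) := by
      intro f m
      rw [coeff_sum]
      simp only [coeff_monomial, Finset.sum_ite_eq', mem_support_iff]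
      split_ifs with hm <;> simp_all
    ext m
    rw [h, coeff_add, coeff_add, h, h, map_add]

theorem coeff_coeffwise (l : K →ₗ[ℚ] ℚ) (f : MvPolynomial σ K) (m : σ →₀ ℕ) :
    coeff m (coeffwise l f) = l (coeff m f) := by
  classical
  change coeff m (∑ m ∈ f.support, monomial m (l (coeff m f))) = l (coeff m f)
  rw [coeff_sum]
  simp only [coeff_monomial, Finset.sum_ite_eq', mem_support_iff]
  split_ifs with hm <;> simp_all

theorem coeffwise_map_mul (l : K →ₗ[ℚ] ℚ) (g : MvPolynomial σ ℚ) (f : MvPolynomial σ K) :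
    coeffwise l (map (algebraMap ℚ K) g * f) = g * coeffwise l f := by
  classical
  ext m
  rw [coeff_coeffwise, coeff_mul, coeff_mul, map_sum]
  refine Finset.sum_congr rfl fun x _ => ?_
  rw [coeff_map, coeff_coeffwise, ← Algebra.smul_def, map_smul, smul_eq_mul]

theorem coeffwise_C (l : K →ₗ[ℚ] ℚ) (k : K) : coeffwise l (C k : MvPolynomial σ K) = C (l k) := by
  classical
  ext m
  rw [coeff_coeffwise, coeff_C, coeff_C]
  split_ifs <;> simp

theorem coeffwise_mem_of_mem_map (l : K →ₗ[ℚ] ℚ) {I : Ideal (MvPolynomial σ ℚ)}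
    {f : MvPolynomial σ K} (hf : f ∈ I.map (map (algebraMap ℚ K))) : coeffwise l f ∈ I := by
  suffices h : ∀ c, coeffwise l (f * c) ∈ I by simpa using h 1
  induction hf using Submodule.span_induction with
  | mem f hf =>
    obtain ⟨g, hg, rfl⟩ := hf
    intro c
    rw [coeffwise_map_mul]
    exact Ideal.mul_mem_right _ _ hg
  | zero => simp
  | add f g _ _ hf hg =>
    intro c
    rw [add_mul, map_add]
    exact add_mem (hf c) (hg c)
  | smul a f _ ih =>
    intro c
    rw [smul_eq_mul, mul_comm a, mul_assoc]
    exact ih (a * c)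

/-- Expand the coefficients in a `ℚ`-basis of `K`. -/
theorem mem_map_of_forall_coeffwise_mem {I : Ideal (MvPolynomial σ ℚ)} {f : MvPolynomial σ K}
    (hf : ∀ l : K →ₗ[ℚ] ℚ, coeffwise l f ∈ I) : f ∈ I.map (map (algebraMap ℚ K)) := by
  classical
  let e := Module.Basis.ofVectorSpace ℚ K
  let s := f.support.biUnion fun m => (e.repr (coeff m f)).support
  have h : f = ∑ k ∈ s, map (algebraMap ℚ K) (coeffwise (e.coord k) f) * C (e k) := by
    ext m
    rw [coeff_sum]
    simp only [mul_comm _ (C _), coeff_C_mul, coeff_map, coeff_coeffwise, Module.Basis.coord_apply,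
      mul_comm (e _), ← Algebra.smul_def]
    conv_lhs => rw [← e.linearCombination_repr (coeff m f)]
    rw [Finsupp.linearCombination_apply, Finsupp.sum]
    refine Finset.sum_subset (fun k hk => ?_) fun k _ hk => by
      rw [Finsupp.notMem_support_iff.mp hk, zero_smul]
    by_cases hm : coeff m f = 0
    · simp [hm] at hk
    · exact Finset.mem_biUnion.mpr ⟨m, mem_support_iff.mpr hm, hk⟩
  rw [h]
  exact sum_mem fun k _ => Ideal.mul_mem_right _ _ (Ideal.mem_map_of_mem _ (hf _))

theorem map_contraction {ι : Type*} (n : ℕ) (f : MvPolynomial (ι × ι) ℚ) :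
    contraction K ι n (map (algebraMap ℚ K) f) = map (algebraMap ℚ K) (contraction ℚ ι n f) := by
  induction f using MvPolynomial.induction_on with
  | C a => simp [contraction]
  | add f g hf hg => simp only [map_add, hf, hg]
  | mul_X f p hf =>
    obtain ⟨i, j⟩ := p
    simp only [map_mul, hf, map_X, contraction_X, map_sum]

theorem coeffwise_contraction {ι : Type*} {n : ℕ} (l : K →ₗ[ℚ] ℚ) (f : MvPolynomial (ι × ι) K) :
    coeffwise l (contraction K ι n f) = contraction ℚ ι n (coeffwise l f) := by
  induction f using MvPolynomial.induction_on' with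
  | monomial m a =>
    have h : (monomial m a : MvPolynomial (ι × ι) K)
        = map (algebraMap ℚ K) (monomial m 1) * C a := by
      rw [map_monomial, map_one, mul_comm, C_mul_monomial, mul_one]
    have hC : contraction K ι n (C a) = C a := by simp [contraction]
    have hC' : ∀ q, contraction ℚ ι n (C q) = C q := by simp [contraction]
    rw [h, map_mul, map_contraction, hC, coeffwise_map_mul, coeffwise_map_mul, coeffwise_C,
      coeffwise_C, map_mul, hC']
  | add f g hf hg => simp only [map_add, hf, hg]

/-- The preimage of the ideal generated by the contractions of the diagonal variables is generated
by the diagonal variables and the minors of size `n + 1`. Over `ℚ` this combines purity with the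
description of the kernel; both sides are compatible with coefficientwise functionals. -/
theorem mem_of_contraction_mem_map {N n : ℕ} (hn : n ≠ 0) {f : MvPolynomial (Fin N × Fin N) K}
    (hf : contraction K (Fin N) n f ∈ (diagonalVarIdeal K (Fin N)).map (contraction K (Fin N) n)) :
    f ∈ diagonalVarIdeal K (Fin N) ⊔ minorIdeal K (Fin N) (n + 1) := by
  have hdiag : diagonalVarIdeal K (Fin N)
      = (diagonalVarIdeal ℚ (Fin N)).map (map (algebraMap ℚ K)) := by
    rw [diagonalVarIdeal, diagonalVarIdeal, Ideal.map_span, ← Set.range_comp]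
    congr 2
    ext1 i
    simp
  have hle : (diagonalVarIdeal ℚ (Fin N) ⊔ minorIdeal ℚ (Fin N) (n + 1)).map
      (map (algebraMap ℚ K)) ≤ diagonalVarIdeal K (Fin N) ⊔ minorIdeal K (Fin N) (n + 1) := by
    rw [Ideal.map_sup, ← hdiag]
    refine sup_le_sup_left ?_ _
    rw [minorIdeal, Ideal.map_span, Ideal.span_le]
    rintro _ ⟨_, ⟨a, b, rfl⟩, rfl⟩
    refine Ideal.subset_span ⟨a, b, ?_⟩
    rw [RingHom.map_det]
    congr 1
    ext1 i j
    simp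
  have hmap : (diagonalVarIdeal K (Fin N)).map (contraction K (Fin N) n)
      ≤ ((diagonalVarIdeal ℚ (Fin N)).map (contraction ℚ (Fin N) n)).map
        (map (algebraMap ℚ K)) := by
    rw [hdiag, Ideal.map_le_iff_le_comap, Ideal.map_le_iff_le_comap]
    intro g hg
    rw [Ideal.mem_comap, Ideal.mem_comap, map_contraction]
    exact Ideal.mem_map_of_mem _ (Ideal.mem_map_of_mem _ hg)
  refine hle (mem_map_of_forall_coeffwise_mem fun l => ?_)
  have h1 := coeffwise_mem_of_mem_map l (hmap hf)
  rw [coeffwise_contraction] at h1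
  obtain ⟨b', hb', hb⟩ := exists_contraction_eq_of_mem h1
  rw [← sub_add_cancel (coeffwise l f) b']
  refine add_mem (Ideal.mem_sup_right ?_) (Ideal.mem_sup_left hb')
  exact mem_minorIdeal_of_contraction_eq_zero hn (by rw [map_sub, hb, sub_self])

end BaseChange

/-! ### Primality of the ideal of incidence relations -/

section Laurent

variable {R ι : Type*} [CommRing R]

/-- The ideal of `R[X_i, Y_i]` generated by the polynomials `X_i Y_i + r_i`. -/
def hyperbolaIdeal (r : ι → R) : Ideal (MvPolynomial (ι ⊕ ι) R) :=
  Ideal.span (Set.range fun i => X (Sum.inl i) * X (Sum.inr i) + C (r i))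

/-- The homomorphism `X_i ↦ T_i`, `Y_i ↦ - r_i T_i⁻¹` to Laurent polynomials. -/
def toLaurent (r : ι → R) [DecidableEq ι] :
    MvPolynomial (ι ⊕ ι) R →ₐ[R] AddMonoidAlgebra R (ι → ℤ) :=
  aeval (Sum.elim (fun i => AddMonoidAlgebra.single (Pi.single i 1) 1)
    fun i => AddMonoidAlgebra.single (-Pi.single i 1) (-r i))

variable [Fintype ι] [DecidableEq ι]

/-- The monomial with exponents `(e i)⁺` at `X_i` and `(e i)⁻` at `Y_i`. -/
def laurentMonomial (R : Type*) [CommRing R] (e : ι → ℤ) : MvPolynomial (ι ⊕ ι) R :=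
  ∏ i, X (Sum.inl i) ^ (e i).toNat * X (Sum.inr i) ^ (-e i).toNat

theorem toLaurent_laurentMonomial (r : ι → R) (e : ι → ℤ) :
    toLaurent r (laurentMonomial R e)
      = AddMonoidAlgebra.single e (∏ i, (-r i) ^ (-e i).toNat) := by
  have h : ∀ i, toLaurent r (X (Sum.inl i) ^ (e i).toNat * X (Sum.inr i) ^ (-e i).toNat)
      = AddMonoidAlgebra.single (Pi.single i (e i)) ((-r i) ^ (-e i).toNat) := by
    intro i
    simp only [toLaurent, map_mul, map_pow, aeval_X, Sum.elim_inl, Sum.elim_inr,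
      AddMonoidAlgebra.single_pow, AddMonoidAlgebra.single_mul_single, one_pow, one_mul]
    congr 1
    ext j
    by_cases hj : j = i
    · subst hj
      simp
      omega
    · simp [hj]
  have hs : ∀ s : Finset ι, ∏ i ∈ s, (AddMonoidAlgebra.single (Pi.single i (e i))
      ((-r i) ^ (-e i).toNat) : AddMonoidAlgebra R (ι → ℤ))
      = AddMonoidAlgebra.single (∑ i ∈ s, Pi.single i (e i)) (∏ i ∈ s, (-r i) ^ (-e i).toNat) := by
    intro s
    induction s using Finset.induction_on with
    | empty => simp [AddMonoidAlgebra.one_def]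
    | insert a s ha ih =>
      rw [Finset.prod_insert ha, Finset.prod_insert ha, Finset.sum_insert ha, ih,
        AddMonoidAlgebra.single_mul_single]
  rw [laurentMonomial, map_prod, Finset.prod_congr rfl fun i _ => h i, hs, Finset.univ_sum_single]

/-- Modulo the relations `X_i Y_i = - r_i`, multiplying by a variable sends a Laurent monomial to a
multiple of a Laurent monomial. -/
theorem exists_laurentMonomial_mul_X (r : ι → R) (e : ι → ℤ) (v : ι ⊕ ι) :
    ∃ c e', laurentMonomial R e * X v - C c * laurentMonomial R e' ∈ hyperbolaIdeal r := by
  have hsplit : ∀ (e : ι → ℤ) (i : ι), laurentMonomial R e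
      = (X (Sum.inl i) ^ (e i).toNat * X (Sum.inr i) ^ (-e i).toNat) *
        ∏ j ∈ Finset.univ.erase i, X (Sum.inl j) ^ (e j).toNat * X (Sum.inr j) ^ (-e j).toNat :=
    fun e i => (Finset.mul_prod_erase _ _ (Finset.mem_univ i)).symm
  have hupd : ∀ (i : ι) (k : ℤ), ∏ j ∈ Finset.univ.erase i,
      (X (Sum.inl j) ^ (Function.update e i k j).toNat
        * X (Sum.inr j) ^ (-Function.update e i k j).toNat : MvPolynomial (ι ⊕ ι) R)
      = ∏ j ∈ Finset.univ.erase i, X (Sum.inl j) ^ (e j).toNat * X (Sum.inr j) ^ (-e j).toNat := by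
    intro i k
    refine Finset.prod_congr rfl fun j hj => ?_
    rw [Function.update_of_ne (Finset.ne_of_mem_erase hj)]
  have hgen : ∀ i, X (Sum.inl i) * X (Sum.inr i) + C (r i) ∈ hyperbolaIdeal r :=
    fun i => Ideal.subset_span ⟨i, rfl⟩
  rcases v with i | i
  · rcases le_or_gt 0 (e i) with he | he
    · refine ⟨1, Function.update e i (e i + 1), ?_⟩
      rw [hsplit e i, hsplit _ i, hupd, Function.update_self, Int.toNat_add he one_pos.le,
        Int.toNat_of_nonpos (z := -e i) (by omega),
        Int.toNat_of_nonpos (z := -(e i + 1)) (by omega)]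
      convert zero_mem (hyperbolaIdeal r) using 1
      simp
      ring
    · refine ⟨-r i, Function.update e i (e i + 1), ?_⟩
      have h1 : (-e i).toNat = (-(e i + 1)).toNat + 1 := by omega
      rw [hsplit e i, hsplit _ i, hupd, Function.update_self, h1,
        Int.toNat_of_nonpos he.le, Int.toNat_of_nonpos (z := e i + 1) (by omega)]
      convert Ideal.mul_mem_left _ (X (Sum.inr i) ^ (-(e i + 1)).toNat * ∏ j ∈ Finset.univ.erase i,
        X (Sum.inl j) ^ (e j).toNat * X (Sum.inr j) ^ (-e j).toNat) (hgen i) using 1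
      simp
      ring
  · rcases le_or_gt (e i) 0 with he | he
    · refine ⟨1, Function.update e i (e i - 1), ?_⟩
      have h1 : (-(e i - 1)).toNat = (-e i).toNat + 1 := by omega
      rw [hsplit e i, hsplit _ i, hupd, Function.update_self, h1,
        Int.toNat_of_nonpos he, Int.toNat_of_nonpos (z := e i - 1) (by omega)]
      convert zero_mem (hyperbolaIdeal r) using 1
      simp
      ring
    · refine ⟨-r i, Function.update e i (e i - 1), ?_⟩
      have h1 : (e i).toNat = (e i - 1).toNat + 1 := by omega
      rw [hsplit e i, hsplit _ i, hupd, Function.update_self, h1,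
        Int.toNat_of_nonpos (z := -e i) (by omega),
        Int.toNat_of_nonpos (z := -(e i - 1)) (by omega)]
      convert Ideal.mul_mem_left _ (X (Sum.inl i) ^ (e i - 1).toNat * ∏ j ∈ Finset.univ.erase i,
        X (Sum.inl j) ^ (e j).toNat * X (Sum.inr j) ^ (-e j).toNat) (hgen i) using 1
      simp
      ring

/-- The ideal `(X_i Y_i + r_i)` is the kernel of the map to Laurent polynomials: modulo it every
polynomial is a combination of Laurent monomials, and these have independent images. -/
theorem hyperbolaIdeal_isPrime [IsDomain R] (r : ι → R) (hr : ∀ i, r i ≠ 0) :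
    (hyperbolaIdeal r).IsPrime := by
  have hle : hyperbolaIdeal r ≤ RingHom.ker (toLaurent r) := by
    refine Ideal.span_le.mpr ?_
    rintro _ ⟨i, rfl⟩
    rw [SetLike.mem_coe, RingHom.mem_ker, map_add, map_mul, ← algebraMap_eq, AlgHom.commutes]
    simp [toLaurent, AddMonoidAlgebra.single_mul_single]
  have hspan : ∀ f, f ∈ (hyperbolaIdeal r).restrictScalars R
      ⊔ Submodule.span R (Set.range (laurentMonomial (ι := ι) R)) := by
    intro f
    induction f using MvPolynomial.induction_on with
    | C a =>
      refine Submodule.mem_sup_right ?_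
      have : C a = a • laurentMonomial (ι := ι) R 0 := by
        simp [laurentMonomial, smul_eq_C_mul]
      rw [this]
      exact Submodule.smul_mem _ _ (Submodule.subset_span ⟨0, rfl⟩)
    | add f g hf hg => exact add_mem hf hg
    | mul_X f v hf =>
      obtain ⟨g, hg, h, hh, rfl⟩ := Submodule.mem_sup.mp hf
      rw [add_mul]
      refine add_mem (Submodule.mem_sup_left (Ideal.mul_mem_right _ _ hg)) ?_
      clear hf hg
      induction hh using Submodule.span_induction with
      | mem h hh =>
        obtain ⟨e, rfl⟩ := hh
        obtain ⟨c, e', hc⟩ := exists_laurentMonomial_mul_X r e v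
        rw [← sub_add_cancel (laurentMonomial R e * X v) (C c * laurentMonomial R e'),
          ← smul_eq_C_mul]
        rw [← smul_eq_C_mul] at hc
        exact add_mem (Submodule.mem_sup_left hc) (Submodule.mem_sup_right
          (Submodule.smul_mem _ _ (Submodule.subset_span ⟨e', rfl⟩)))
      | zero => simp
      | add a b _ _ ha hb =>
        rw [add_mul]
        exact add_mem ha hb
      | smul c a _ ha =>
        rw [smul_mul_assoc]
        exact Submodule.smul_mem _ _ ha
  have hker : hyperbolaIdeal r = RingHom.ker (toLaurent r) := by
    refine le_antisymm hle fun f hf => ?_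
    obtain ⟨g, hg, h, hh, rfl⟩ := Submodule.mem_sup.mp (hspan f)
    obtain ⟨c, rfl⟩ := Finsupp.mem_span_range_iff_exists_finsupp.mp hh
    have h0 : toLaurent r (c.sum fun e a => a • laurentMonomial R e) = 0 := by
      have h1 := RingHom.mem_ker.mp (hle hg)
      have h2 := RingHom.mem_ker.mp hf
      rwa [map_add, h1, zero_add] at h2
    have hc : c = 0 := by
      ext e
      have h1 :
          (c.sum fun e a => AddMonoidAlgebra.single e (a * ∏ i, (-r i) ^ (-e i).toNat)) = 0 := by
        rw [← h0, Finsupp.sum, Finsupp.sum, map_sum]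
        refine Finset.sum_congr rfl fun e _ => ?_
        rw [map_smul, toLaurent_laurentMonomial, AddMonoidAlgebra.smul_single, smul_eq_mul]
      have h2 := DFunLike.congr_fun (congrArg AddMonoidAlgebra.coeff h1) e
      rw [Finsupp.sum, AddMonoidAlgebra.coeff_sum, Finsupp.finsetSum_apply,
        Finset.sum_eq_single e] at h2
      · simp only [AddMonoidAlgebra.coeff_single, Finsupp.single_eq_same] at h2
        refine (mul_eq_zero.mp h2).resolve_right (Finset.prod_ne_zero_iff.mpr fun i _ => ?_)
        exact pow_ne_zero _ (neg_ne_zero.mpr (hr i))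
      · intro e' _ he'
        simp [he']
      · intro he
        simp [Finsupp.notMem_support_iff.mp he]
    subst hc
    simpa using hg
  rw [hker]
  exact RingHom.ker_isPrime _

end Laurent

section Incidence

variable {K ι : Type*} [Field K] [CharZero K]

/-- Separate the coordinates `x_{i,0}`, `y_{i,0}` from the other ones. -/
def coordinateEquiv (ι : Type*) (k : ℕ) :
    ι × (Fin (k + 1) ⊕ Fin (k + 1)) ≃ (ι ⊕ ι) ⊕ ι × (Fin k ⊕ Fin k) where
  toFun v := match v with
    | (i, Sum.inl a) => Fin.cases (Sum.inl (Sum.inl i)) (fun a => Sum.inr (i, Sum.inl a)) a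
    | (i, Sum.inr a) => Fin.cases (Sum.inl (Sum.inr i)) (fun a => Sum.inr (i, Sum.inr a)) a
  invFun v := match v with
    | Sum.inl (Sum.inl i) => (i, Sum.inl 0)
    | Sum.inl (Sum.inr i) => (i, Sum.inr 0)
    | Sum.inr (i, Sum.inl a) => (i, Sum.inl a.succ)
    | Sum.inr (i, Sum.inr a) => (i, Sum.inr a.succ)
  left_inv v := by
    obtain ⟨i, a | a⟩ := v <;> induction a using Fin.cases <;> rfl
  right_inv v := by
    obtain (i | i) | ⟨i, a | a⟩ := v <;> rfl

/-- In dimension at least two, the incidence relations `∑ₐ x_{i,a} y_{i,a}` generate a prime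
ideal. -/
theorem map_contraction_diagonalVarIdeal_isPrime [Finite ι] {n : ℕ} (hn : 2 ≤ n) :
    ((diagonalVarIdeal K ι).map (contraction K ι n)).IsPrime := by
  classical
  have := Fintype.ofFinite ι
  obtain ⟨k, rfl⟩ : ∃ k, n = k + 1 := ⟨n - 1, by omega⟩
  let Θ : MvPolynomial (ι × (Fin (k + 1) ⊕ Fin (k + 1))) K ≃ₐ[K]
      MvPolynomial (ι ⊕ ι) (MvPolynomial (ι × (Fin k ⊕ Fin k)) K) :=
    (renameEquiv K (coordinateEquiv ι k)).trans (sumAlgEquiv K _ _)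
  let r : ι → MvPolynomial (ι × (Fin k ⊕ Fin k)) K := fun i =>
    ∑ a, X (i, Sum.inl a) * X (i, Sum.inr a)
  have hr : ∀ i, r i ≠ 0 := by
    intro i h
    have h1 := congrArg (eval fun _ => (1 : K)) h
    simp only [r, map_sum, map_mul, eval_X, mul_one, Finset.sum_const, Finset.card_univ,
      Fintype.card_fin, nsmul_eq_mul, map_zero, Nat.cast_eq_zero] at h1
    omega
  have hmap : ((diagonalVarIdeal K ι).map (contraction K ι (k + 1))).map Θ = hyperbolaIdeal r := by
    rw [diagonalVarIdeal, Ideal.map_span, Ideal.map_span, ← Set.range_comp, ← Set.range_comp,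
      hyperbolaIdeal]
    congr 2
    ext1 i
    simp only [Function.comp_apply, contraction_X, Fin.sum_univ_succ, map_add, map_mul, map_sum, r]
    simp [Θ, coordinateEquiv]
  have hprime := hyperbolaIdeal_isPrime r hr
  rw [← hmap] at hprime
  rw [← Ideal.comap_map_of_bijective Θ Θ.bijective
    (I := (diagonalVarIdeal K ι).map (contraction K ι (k + 1)))]
  exact Ideal.IsPrime.comap _

/-- The determinant is `1` and the incidence relations vanish when the `x_{a i}` form the standard
basis and all covectors are zero. -/
theorem det_vectorMatrix_notMem {n : ℕ} {a : Fin n → ι} (ha : Function.Injective a) :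
    (vectorMatrix K n a).det ∉ (diagonalVarIdeal K ι).map (contraction K ι n) := by
  classical
  intro h
  let ev : MvPolynomial (ι × (Fin n ⊕ Fin n)) K →ₐ[K] K :=
    aeval fun v => Sum.elim (fun c => if v.1 = a c then 1 else 0) (fun _ => 0) v.2
  have hle : (diagonalVarIdeal K ι).map (contraction K ι n) ≤ RingHom.ker ev := by
    rw [diagonalVarIdeal, Ideal.map_span, Ideal.span_le]
    rintro _ ⟨_, ⟨i, rfl⟩, rfl⟩
    rw [SetLike.mem_coe, RingHom.mem_ker, contraction_X]
    simp [ev]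
  have h0 := RingHom.mem_ker.mp (hle h)
  have h1 : ev.mapMatrix (vectorMatrix K n a) = 1 := by
    ext i j
    simp [ev, vectorMatrix, Matrix.one_apply, ha.eq_iff]
  rw [AlgHom.map_det, h1, Matrix.det_one] at h0
  exact one_ne_zero h0

theorem det_covectorMatrix_notMem {n : ℕ} {b : Fin n → ι} (hb : Function.Injective b) :
    (covectorMatrix K n b).det ∉ (diagonalVarIdeal K ι).map (contraction K ι n) := by
  classical
  intro h
  let ev : MvPolynomial (ι × (Fin n ⊕ Fin n)) K →ₐ[K] K :=
    aeval fun v => Sum.elim (fun _ => 0) (fun c => if b c = v.1 then 1 else 0) v.2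
  have hle : (diagonalVarIdeal K ι).map (contraction K ι n) ≤ RingHom.ker ev := by
    rw [diagonalVarIdeal, Ideal.map_span, Ideal.span_le]
    rintro _ ⟨_, ⟨i, rfl⟩, rfl⟩
    rw [SetLike.mem_coe, RingHom.mem_ker, contraction_X]
    simp [ev]
  have h0 := RingHom.mem_ker.mp (hle h)
  have h1 : ev.mapMatrix (covectorMatrix K n b) = 1 := by
    ext i j
    simp [ev, covectorMatrix, Matrix.one_apply, hb.eq_iff]
  rw [AlgHom.map_det, h1, Matrix.det_one] at h0
  exact one_ne_zero h0

end Incidence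

/-! ### Regular minors of size `n` -/

section Regular

variable {K : Type*} [Field K] [CharZero K] {n : ℕ}

/-- For finitely many points: the contraction of the minor is `det (x_a) * det (y_b)`, and neither
factor lies in the prime ideal of incidence relations. -/
theorem mem_of_mul_det_mem_fin (hn : 2 ≤ n) {N : ℕ} {a b : Fin n → Fin N}
    (ha : Function.Injective a) (hb : Function.Injective b) {f : MvPolynomial (Fin N × Fin N) K}
    (hf : f * (Matrix.of fun i j => X (a i, b j)).det
      ∈ diagonalVarIdeal K (Fin N) ⊔ minorIdeal K (Fin N) (n + 1)) :
    f ∈ diagonalVarIdeal K (Fin N) ⊔ minorIdeal K (Fin N) (n + 1) := by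
  refine mem_of_contraction_mem_map (by omega) ?_
  have hprime := map_contraction_diagonalVarIdeal_isPrime (K := K) (ι := Fin N) hn
  have hle : diagonalVarIdeal K (Fin N) ⊔ minorIdeal K (Fin N) (n + 1)
      ≤ ((diagonalVarIdeal K (Fin N)).map (contraction K (Fin N) n)).comap
        (contraction K (Fin N) n) := by
    refine sup_le Ideal.le_comap_map (Ideal.span_le.mpr ?_)
    rintro _ ⟨a, b, rfl⟩
    rw [SetLike.mem_coe, Ideal.mem_comap, contraction_det, det_mul_eq_zero_of_width_lt]
    exact zero_mem _
  have h := hle hf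
  rw [Ideal.mem_comap, map_mul, contraction_det, Matrix.det_mul] at h
  refine (hprime.mem_or_mem h).resolve_right fun h' => ?_
  exact (hprime.mem_or_mem h').elim (det_vectorMatrix_notMem ha) (det_covectorMatrix_notMem hb)

/-- Minors of size `n` on distinct rows and distinct columns are regular modulo the diagonal
variables and the minors of size `n + 1`: only finitely many points are involved, and the others
may be set to zero. -/
theorem mem_of_mul_det_mem (hn : 2 ≤ n) {ι : Type*} {a b : Fin n → ι}
    (ha : Function.Injective a) (hb : Function.Injective b) {f : MvPolynomial (ι × ι) K}
    (hf : f * (Matrix.of fun i j => X (a i, b j)).det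
      ∈ diagonalVarIdeal K ι ⊔ minorIdeal K ι (n + 1)) :
    f ∈ diagonalVarIdeal K ι ⊔ minorIdeal K ι (n + 1) := by
  classical
  let T : Finset ι := f.vars.image Prod.fst ∪ f.vars.image Prod.snd ∪ Finset.univ.image a
    ∪ Finset.univ.image b
  let e : Fin T.card → ι := fun i => T.equivFin.symm i
  have he : Function.Injective e := Subtype.val_injective.comp T.equivFin.symm.injective
  have hmem : ∀ t ∈ T, ∃ i, e i = t := fun t ht => ⟨T.equivFin ⟨t, ht⟩, by simp [e]⟩
  have hee : Function.Injective (Prod.map e e) := he.prodMap he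
  obtain ⟨g, hg⟩ : ∃ g, rename (Prod.map e e) g = f := by
    refine exists_rename_eq_of_vars_subset_range f _ hee fun v hv => ?_
    obtain ⟨i, hi⟩ := hmem v.1 (by
      simp only [T, Finset.mem_union]
      exact Or.inl (Or.inl (Or.inl (Finset.mem_image_of_mem _ hv))))
    obtain ⟨j, hj⟩ := hmem v.2 (by
      simp only [T, Finset.mem_union]
      exact Or.inl (Or.inl (Or.inr (Finset.mem_image_of_mem _ hv))))
    exact ⟨(i, j), Prod.ext hi hj⟩
  choose a' ha' using fun i => hmem (a i) (by simp [T])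
  choose b' hb' using fun i => hmem (b i) (by simp [T])
  have hdet : (Matrix.of fun i j => X (a i, b j) : Matrix _ _ (MvPolynomial (ι × ι) K)).det
      = rename (Prod.map e e) (Matrix.of fun i j => X (a' i, b' j)).det := by
    rw [AlgHom.map_det]
    congr 1
    ext1 i j
    simp [ha', hb']
  have hup : diagonalVarIdeal K (Fin T.card) ⊔ minorIdeal K (Fin T.card) (n + 1)
      ≤ (diagonalVarIdeal K ι ⊔ minorIdeal K ι (n + 1)).comap (rename (Prod.map e e)) := by
    refine sup_le (Ideal.span_le.mpr ?_) (Ideal.span_le.mpr ?_)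
    · rintro _ ⟨i, rfl⟩
      rw [SetLike.mem_coe, Ideal.mem_comap, rename_X]
      exact Ideal.mem_sup_left (Ideal.subset_span ⟨e i, rfl⟩)
    · rintro _ ⟨c, d, rfl⟩
      rw [SetLike.mem_coe, Ideal.mem_comap, AlgHom.map_det]
      refine Ideal.mem_sup_right (Ideal.subset_span ⟨e ∘ c, e ∘ d, ?_⟩)
      congr 1
      ext1 i j
      simp
  have hkill : ∀ p : ι × ι, (∀ q, Prod.map e e q ≠ p) →
      killCompl hee (X p : MvPolynomial _ K) = 0 := by
    intro p hp
    rw [killCompl, aeval_X, dif_neg]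
    exact fun ⟨q, hq⟩ => hp q hq
  have hX : ∀ i j, killCompl hee (X (e i, e j) : MvPolynomial _ K) = X (i, j) := by
    intro i j
    have := killCompl_rename_app hee (X (i, j) : MvPolynomial _ K)
    rwa [rename_X] at this
  have hdown : diagonalVarIdeal K ι ⊔ minorIdeal K ι (n + 1)
      ≤ (diagonalVarIdeal K (Fin T.card) ⊔ minorIdeal K (Fin T.card) (n + 1)).comap
        (killCompl hee) := by
    refine sup_le (Ideal.span_le.mpr ?_) (Ideal.span_le.mpr ?_)
    · rintro _ ⟨i, rfl⟩
      rw [SetLike.mem_coe, Ideal.mem_comap]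
      by_cases hi : ∃ j, e j = i
      · obtain ⟨j, rfl⟩ := hi
        rw [hX]
        exact Ideal.mem_sup_left (Ideal.subset_span ⟨j, rfl⟩)
      · rw [hkill (i, i) fun q hq => hi ⟨q.1, congrArg Prod.fst hq⟩]
        exact zero_mem _
    · rintro _ ⟨c, d, rfl⟩
      rw [SetLike.mem_coe, Ideal.mem_comap, AlgHom.map_det]
      by_cases hc : ∀ i, ∃ j, e j = c i
      · by_cases hd : ∀ i, ∃ j, e j = d i
        · choose c' hc' using hc
          choose d' hd' using hd
          refine Ideal.mem_sup_right (Ideal.subset_span ⟨c', d', ?_⟩)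
          congr 1
          ext1 i j
          simp [← hc', ← hd', hX]
        · obtain ⟨i, hi⟩ := not_forall.mp hd
          rw [Matrix.det_eq_zero_of_column_eq_zero i fun j => by
            exact hkill (c j, d i) fun q hq => hi ⟨q.2, congrArg Prod.snd hq⟩]
          exact zero_mem _
      · obtain ⟨i, hi⟩ := not_forall.mp hc
        rw [Matrix.det_eq_zero_of_row_eq_zero i fun j => by
          exact hkill (c i, d j) fun q hq => hi ⟨q.1, congrArg Prod.fst hq⟩]
        exact zero_mem _
  rw [← hg] at hf ⊢
  refine hup (mem_of_mul_det_mem_fin hn (a := a') (b := b') ?_ ?_ ?_)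
  · exact fun i j hij => ha (by rw [← ha', ← ha', hij])
  · exact fun i j hij => hb (by rw [← hb', ← hb', hij])
  · rw [hdet, ← map_mul] at hf
    have := hdown hf
    rwa [Ideal.mem_comap, killCompl_rename_app] at this

end Regular

/-! ### Determinants in the rank `n` swapping ring -/

section Units

variable {K : Type*} [Field K] {P : Set UnitAddCircle} {n : ℕ}

theorem rankMk_swapMk_eq_zero_iff (f : SwapPoly K P) :
    RankRing.mk K P n (SwapRing.mk K P f) = 0
      ↔ f ∈ diagonalVarIdeal K P ⊔ minorIdeal K P (n + 1) := by
  have hrank : rankIdeal K P n = (minorIdeal K P (n + 1)).map (SwapRing.mk K P) := by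
    rw [rankIdeal, minorIdeal, Ideal.map_span]
    congr 1
    ext D
    constructor
    · rintro ⟨x, y, rfl⟩
      refine ⟨_, ⟨x, y, rfl⟩, ?_⟩
      rw [AlgHom.map_det]
      rfl
    · rintro ⟨_, ⟨x, y, rfl⟩, rfl⟩
      refine ⟨x, y, ?_⟩
      rw [AlgHom.map_det]
      rfl
  have hker : (⊥ : Ideal (SwapRing K P)).comap (SwapRing.mk K P) = diagonalVarIdeal K P := by
    ext g
    rw [Ideal.mem_comap, Ideal.mem_bot, SwapRing.mk_eq_zero_iff]
    rfl
  rw [RankRing.mk_eq_zero_iff, hrank, ← Ideal.mem_comap,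
    Ideal.comap_map_of_surjective _ (SwapRing.mk_surjective K P), hker, sup_comm]

theorem isUnit_rankDet [CharZero K] (hn : 2 ≤ n) {x y : Fin n → P} (hx : Function.Injective x)
    (hy : Function.Injective y) : IsUnit (rankDet K n x y) := by
  have hmem : RankRing.mk K P n (swapDet K x y) ∈ nonZeroDivisors (RankRing K P n) := by
    refine mem_nonZeroDivisors_iff_right.mpr fun r hr => ?_
    obtain ⟨s, rfl⟩ := RankRing.mk_surjective K P n r
    obtain ⟨f, rfl⟩ := SwapRing.mk_surjective K P s
    have hdet : swapDet K x y = SwapRing.mk K P (Matrix.of fun i j => X (x i, y j)).det := by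
      rw [AlgHom.map_det]
      rfl
    rw [hdet, ← map_mul, ← map_mul, rankMk_swapMk_eq_zero_iff] at hr
    exact (rankMk_swapMk_eq_zero_iff f).mpr (mem_of_mul_det_mem hn hx hy hr)
  exact IsLocalization.map_units (RankFractionRing K P n)
    (⟨_, hmem⟩ : nonZeroDivisors (RankRing K P n))

end Units

/-! ### The bracket of two determinants -/

section Bracket

variable {K : Type*} [Field K] {P : Set UnitAddCircle}

theorem derivation_det_updateRow {A : Type*} [CommRing A] [Algebra K A] {n : ℕ}
    (D : Derivation K A A) (M : Matrix (Fin n) (Fin n) A) :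
    D M.det = ∑ i, (M.updateRow i fun j => D (M i j)).det := by
  rw [derivation_det]
  exact sum_updateCol_eq_sum_updateRow M fun i j => D (M i j)

theorem swapDet_update_row {n : ℕ} (x y : Fin n → P) (i : Fin n) (t : P) :
    swapDet K (Function.update x i t) y
      = ((Matrix.of fun i j => pair K (x i) (y j)).updateRow i fun j => pair K t (y j)).det := by
  rw [swapDet]
  congr 1
  ext k j
  by_cases hk : k = i
  · subst hk; simp
  · simp [hk]

theorem swapDet_eq_zero_of_eq {n : ℕ} {x y : Fin n → P} {i j : Fin n} (hij : i ≠ j)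
    (h : x i = x j) : swapDet K x y = 0 :=
  Matrix.det_zero_of_row_eq hij (by ext k; simp [h])

variable [CharZero K]

/-- If the linking numbers `𝓙(a_i v_j, b_k u_l)` do not depend on `j` and `l`, then the bracket of
`Δ(a, v)` and `Δ(b, u)` is a sum over exchanges of `a_i` with `b_k`. -/
theorem swapBracket_swapDet {n n' : ℕ} (a v : Fin n → P) (b u : Fin n' → P)
    (J : Fin n → Fin n' → ℚ)
    (hJ : ∀ i j k l, linkingNumber (a i) (v j) (b k) (u l) = J i k) :
    swapBracket K P (swapDet K a v) (swapDet K b u)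
      = ∑ k, ∑ i, algebraMap K _ (J i k : K) *
          (swapDet K (Function.update a i (b k)) v * swapDet K (Function.update b k (a i)) u) := by
  have hinner : ∀ k l, swapBracket K P (swapDet K a v) (pair K (b k) (u l))
      = ∑ i, algebraMap K _ (J i k : K) * swapDet K (Function.update a i (b k)) v
          * pair K (a i) (u l) := by
    intro k l
    rw [swapBracket_antisymm]
    conv_lhs => rw [swapDet]
    rw [derivation_det_updateRow, ← Finset.sum_neg_distrib]
    refine Finset.sum_congr rfl fun i _ => ?_
    have hrow : (fun j => swapBracket K P (pair K (b k) (u l))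
        ((Matrix.of fun i j => pair K (a i) (v j)) i j))
        = (-(algebraMap K _ (J i k : K) * pair K (a i) (u l))) • fun j => pair K (b k) (v j) := by
      ext j
      rw [Matrix.of_apply, swapBracket_antisymm, swapBracket_pair, hJ, Pi.smul_apply, smul_eq_mul]
      ring
    rw [hrow, Matrix.det_updateRow_smul, ← swapDet_update_row]
    ring
  conv_lhs => enter [2]; rw [swapDet]
  rw [derivation_det_updateRow]
  refine Finset.sum_congr rfl fun k _ => ?_
  have hrow : (fun l => swapBracket K P (swapDet K a v)
      ((Matrix.of fun i j => pair K (b i) (u j)) k l))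
      = ∑ i, (algebraMap K _ (J i k : K) * swapDet K (Function.update a i (b k)) v)
          • fun l => pair K (a i) (u l) := by
    ext l
    rw [Matrix.of_apply, hinner, Finset.sum_apply]
    rfl
  rw [hrow, ← Matrix.cramer_transpose_apply, map_sum, Finset.sum_apply]
  refine Finset.sum_congr rfl fun i _ => ?_
  rw [map_smul, Pi.smul_apply, Matrix.cramer_transpose_apply, ← swapDet_update_row, smul_eq_mul,
    mul_assoc]

/-- An exchange of `a_i ≠ b_k` contributes zero if `a_i` is among the `b`'s or `b_k` is among the
`a`'s, because it creates a repeated row. -/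
theorem swapBracket_swapDet_eq_mul {n n' : ℕ} (a v : Fin n → P) (b u : Fin n' → P)
    (J : Fin n → Fin n' → ℚ)
    (hJ : ∀ i j k l, linkingNumber (a i) (v j) (b k) (u l) = J i k)
    (hJ0 : ∀ i k, b k ∉ Set.range a → a i ∉ Set.range b → J i k = 0) :
    swapBracket K P (swapDet K a v) (swapDet K b u)
      = algebraMap K _ ((∑ k, ∑ i, if a i = b k then J i k else 0 : ℚ) : K) *
          (swapDet K a v * swapDet K b u) := by
  rw [swapBracket_swapDet a v b u J hJ, Rat.cast_sum, map_sum, Finset.sum_mul]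
  refine Finset.sum_congr rfl fun k _ => ?_
  rw [Rat.cast_sum, map_sum, Finset.sum_mul]
  refine Finset.sum_congr rfl fun i _ => ?_
  by_cases hik : a i = b k
  · rw [if_pos hik, ← hik, Function.update_eq_self, hik, Function.update_eq_self]
  · rw [if_neg hik, Rat.cast_zero, map_zero, zero_mul]
    by_cases hb : b k ∈ Set.range a
    · obtain ⟨i', hi'⟩ := hb
      have hne : i ≠ i' := fun h => hik (h ▸ hi')
      rw [swapDet_eq_zero_of_eq (x := Function.update a i (b k)) hne (by simp [hne.symm, hi']),
        zero_mul, mul_zero]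
    · by_cases ha : a i ∈ Set.range b
      · obtain ⟨k', hk'⟩ := ha
        have hne : k ≠ k' := fun h => hik (h ▸ hk'.symm)
        rw [swapDet_eq_zero_of_eq (x := Function.update b k (a i)) hne (by simp [hne.symm, hk']),
          mul_zero, mul_zero]
      · rw [hJ0 i k hb ha, Rat.cast_zero, map_zero, zero_mul]

end Bracket

/-! ### Triples of flags -/

section Triple

variable {P : Set UnitAddCircle} {N n m l p : ℕ} {x y z : Fin N → P}
  {hm : m ≤ N} {hl : l ≤ N} {hp : p ≤ N} {h : m + l + p = n}

theorem sum_tripleTuple {M : Type*} [AddCommMonoid M] (F : P → M) :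
    ∑ i, F (tripleTuple x y z hm hl hp h i)
      = ∑ a : Fin m, F (x (Fin.castLE hm a)) + ∑ a : Fin l, F (y (Fin.castLE hl a))
        + ∑ a : Fin p, F (z (Fin.castLE hp a)) := by
  subst h
  rw [Fin.sum_univ_add, Fin.sum_univ_add]
  simp [tripleTuple, Fin.take]

theorem forall_tripleTuple {Q : P → Prop} :
    (∀ i, Q (tripleTuple x y z hm hl hp h i))
      ↔ (∀ a : Fin N, (a : ℕ) < m → Q (x a)) ∧ (∀ a : Fin N, (a : ℕ) < l → Q (y a)) ∧
        (∀ a : Fin N, (a : ℕ) < p → Q (z a)) := by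
  subst h
  have hlt : ∀ {k : ℕ} (hk : k ≤ N) (w : Fin N → P),
      (∀ a : Fin k, Q (w (Fin.castLE hk a))) ↔ ∀ a : Fin N, (a : ℕ) < k → Q (w a) := fun hk w =>
    ⟨fun h a ha => h ⟨a, ha⟩, fun h a => h _ a.2⟩
  rw [← hlt hm, ← hlt hl, ← hlt hp]
  constructor
  · intro H
    refine ⟨fun a => ?_, fun a => ?_, fun a => ?_⟩
    · simpa [tripleTuple, Fin.take] using H (Fin.castAdd p (Fin.castAdd l a))
    · simpa [tripleTuple, Fin.take] using H (Fin.castAdd p (Fin.natAdd m a))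
    · simpa [tripleTuple, Fin.take] using H (Fin.natAdd (m + l) a)
  · rintro ⟨H1, H2, H3⟩ i
    induction i using Fin.addCases with
    | left i =>
      induction i using Fin.addCases with
      | left i => simpa [tripleTuple, Fin.take] using H1 i
      | right i => simpa [tripleTuple, Fin.take] using H2 i
    | right i => simpa [tripleTuple, Fin.take] using H3 i

theorem tripleTuple_injective (hx : Function.Injective x) (hy : Function.Injective y)
    (hz : Function.Injective z) (hxy : ∀ a b, x a ≠ y b) (hxz : ∀ a b, x a ≠ z b)
    (hyz : ∀ a b, y a ≠ z b) : Function.Injective (tripleTuple x y z hm hl hp h) := by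
  subst h
  have hcast : ∀ {k : ℕ} (hk : k ≤ N) {w : Fin N → P}, Function.Injective w →
      Function.Injective (Fin.take k hk w) := fun hk _ hw =>
    hw.comp (Fin.castLE_injective hk)
  refine Fin.append_injective_iff.mpr ⟨Fin.append_injective_iff.mpr
    ⟨hcast hm hx, hcast hl hy, fun a b => hxy _ _⟩, hcast hp hz, fun a b => ?_⟩
  induction a using Fin.addCases with
  | left a => simpa [Fin.take] using hxz _ _
  | right a => simpa [Fin.take] using hyz _ _

theorem sum_ite_castLE_eq {k k' : ℕ} (hk : k ≤ N) (hk' : k' ≤ N) (c : ℚ) :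
    ∑ b : Fin k', ∑ a : Fin k, (if Fin.castLE hk a = Fin.castLE hk' b then c else 0)
      = (min k k' : ℕ) * c := by
  have h1 : ∀ b : Fin k', ∑ a : Fin k,
      (if Fin.castLE hk a = Fin.castLE hk' b then c else 0)
        = if (b : ℕ) < k then c else 0 := by
    intro b
    simp only [Fin.ext_iff, Fin.val_castLE]
    split_ifs with hb
    · rw [Finset.sum_eq_single ⟨b, hb⟩]
      · simp
      · intro a _ ha
        rw [if_neg fun h => ha (Fin.ext h)]
      · simp
    · refine Finset.sum_eq_zero fun a _ => ?_
      rw [if_neg (by omega)]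
  rw [Finset.sum_congr rfl fun b _ => h1 b,
    Fin.sum_univ_eq_sum_range (fun b => if b < k then c else 0),
    ← Finset.sum_filter, Finset.sum_const, nsmul_eq_mul]
  congr 2
  have : (Finset.range k').filter (· < k) = Finset.range (min k k') := by
    ext b
    simp [and_comm]
  rw [this, Finset.card_range]

end Triple

/-! ### Linking numbers of points on an interval -/

theorem signature_sub_eq_one {a b : ℝ} (h : b < a) : signature (a - b) = 1 :=
  signature_pos (by linarith)

theorem signature_sub_eq_neg_one {a b : ℝ} (h : a < b) : signature (a - b) = -1 :=
  signature_neg (by linarith)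

/-- When `u` is the last point and `e`, `f` record the sides of `v` on which `r` and `s` lie, the
linking number only depends on `e`, `f` and the relative position of `r` and `s`. -/
theorem linkingNumber_eq_of_lt {o r v s u : UnitAddCircle} {e f : ℚ} (hru : coord o r < coord o u)
    (hvu : coord o v < coord o u) (he : signature (coord o r - coord o v) = e)
    (hf : signature (coord o s - coord o v) = f) :
    linkingNumber r v s u = -(1 / 2) * e * (1 + f * signature (coord o r - coord o s)) := by
  rw [linkingNumber_eq o, linkingNumberAt, he, hf, signature_sub_eq_neg_one hru,
    signature_sub_eq_one hvu]
  ring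

/-! ### Flags in cyclic order -/

section Main

variable {P : Set UnitAddCircle} {N n : ℕ} {x y z : Fin N → P} {v u : Fin n → P}

/-- The order relations between the points, read on the circle cut at a point `o` between the `u`'s
and the `x`'s: the blocks come in the order `x`, `v`, `y`, `z`, `u`, and inside `x`, `y` and `z` the
points are numbered backwards. -/
structure FlagOrder (o : UnitAddCircle) (x y z : Fin N → P) (v u : Fin n → P) : Prop where
  x_anti : ∀ i j, i < j → coord o (x j) < coord o (x i)
  y_anti : ∀ i j, i < j → coord o (y j) < coord o (y i)
  z_anti : ∀ i j, i < j → coord o (z j) < coord o (z i)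
  v_mono : ∀ i j, i < j → coord o (v i) < coord o (v j)
  u_mono : ∀ i j, i < j → coord o (u i) < coord o (u j)
  x_lt_v : ∀ i j, coord o (x i) < coord o (v j)
  v_lt_y : ∀ i j, coord o (v i) < coord o (y j)
  y_lt_z : ∀ i j, coord o (y i) < coord o (z j)
  x_lt_y : ∀ i j, coord o (x i) < coord o (y j)
  x_lt_z : ∀ i j, coord o (x i) < coord o (z j)
  v_lt_z : ∀ i j, coord o (v i) < coord o (z j)
  x_lt_u : ∀ i j, coord o (x i) < coord o (u j)
  v_lt_u : ∀ i j, coord o (v i) < coord o (u j)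
  y_lt_u : ∀ i j, coord o (y i) < coord o (u j)
  z_lt_u : ∀ i j, coord o (z i) < coord o (u j)

theorem exists_flagOrder (hord : OrderedAnticlockwise
      (((List.ofFn x).reverse ++ List.ofFn v ++ (List.ofFn y).reverse ++ (List.ofFn z).reverse
        ++ List.ofFn u).map Subtype.val)) : ∃ o, FlagOrder o x y z v u := by
  obtain ⟨o, -, ho⟩ := hord
  simp only [List.pairwise_map, List.pairwise_append, List.pairwise_reverse, List.pairwise_ofFn,
    List.mem_append, List.mem_reverse, List.mem_ofFn] at ho
  obtain ⟨⟨⟨⟨hx, hv, hxv⟩, hy, hxvy⟩, hz, hxvyz⟩, hu, hall⟩ := ho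
  refine ⟨o, ?_⟩
  constructor
  · exact fun i j hij => hx hij
  · exact fun i j hij => hy hij
  · exact fun i j hij => hz hij
  · exact fun i j hij => hv hij
  · exact fun i j hij => hu hij
  · exact fun i j => hxv _ ⟨i, rfl⟩ _ ⟨j, rfl⟩
  · exact fun i j => hxvy _ (.inr ⟨i, rfl⟩) _ ⟨j, rfl⟩
  · exact fun i j => hxvyz _ (.inr ⟨i, rfl⟩) _ ⟨j, rfl⟩
  · exact fun i j => hxvy _ (.inl ⟨i, rfl⟩) _ ⟨j, rfl⟩
  · exact fun i j => hxvyz _ (.inl (.inl ⟨i, rfl⟩)) _ ⟨j, rfl⟩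
  · exact fun i j => hxvyz _ (.inl (.inr ⟨i, rfl⟩)) _ ⟨j, rfl⟩
  · exact fun i j => hall _ (.inl (.inl (.inl ⟨i, rfl⟩))) _ ⟨j, rfl⟩
  · exact fun i j => hall _ (.inl (.inl (.inr ⟨i, rfl⟩))) _ ⟨j, rfl⟩
  · exact fun i j => hall _ (.inl (.inr ⟨i, rfl⟩)) _ ⟨j, rfl⟩
  · exact fun i j => hall _ (.inr ⟨i, rfl⟩) _ ⟨j, rfl⟩

theorem injective_of_coord {k : ℕ} {o : UnitAddCircle} {w : Fin k → P}
    (hw : ∀ i j, i < j → coord o (w i) ≠ coord o (w j)) : Function.Injective w := by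
  intro i j hij
  rcases lt_trichotomy i j with h | h | h
  · exact absurd (by rw [hij]) (hw i j h)
  · exact h
  · exact absurd (by rw [hij]) (hw j i h)

namespace FlagOrder

variable {o : UnitAddCircle}

theorem x_injective (H : FlagOrder o x y z v u) : Function.Injective x :=
  injective_of_coord fun i j h => (H.x_anti i j h).ne'

theorem y_injective (H : FlagOrder o x y z v u) : Function.Injective y :=
  injective_of_coord fun i j h => (H.y_anti i j h).ne'

theorem z_injective (H : FlagOrder o x y z v u) : Function.Injective z :=
  injective_of_coord fun i j h => (H.z_anti i j h).ne'

theorem v_injective (H : FlagOrder o x y z v u) : Function.Injective v :=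
  injective_of_coord fun i j h => (H.v_mono i j h).ne

theorem u_injective (H : FlagOrder o x y z v u) : Function.Injective u :=
  injective_of_coord fun i j h => (H.u_mono i j h).ne

theorem x_ne_y (H : FlagOrder o x y z v u) (i j : Fin N) : x i ≠ y j :=
  fun h => (H.x_lt_y i j).ne (by rw [h])

theorem x_ne_z (H : FlagOrder o x y z v u) (i j : Fin N) : x i ≠ z j :=
  fun h => (H.x_lt_z i j).ne (by rw [h])

theorem y_ne_z (H : FlagOrder o x y z v u) (i j : Fin N) : y i ≠ z j :=
  fun h => (H.y_lt_z i j).ne (by rw [h])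

variable {m l p m' l' p' : ℕ} {hm : m ≤ N} {hl : l ≤ N} {hp : p ≤ N}
  {hm' : m' ≤ N} {hl' : l' ≤ N} {hp' : p' ≤ N} {h : m + l + p = n} {h' : m' + l' + p' = n}

theorem tripleTuple_injective (H : FlagOrder o x y z v u) :
    Function.Injective (tripleTuple x y z hm hl hp h) :=
  Swapping.tripleTuple_injective H.x_injective H.y_injective H.z_injective H.x_ne_y H.x_ne_z
    H.y_ne_z

/-- The bracket of the two determinants, already before passing to rank `n`. The constant collects
the linking numbers of the points common to both tuples: `1/2` for an `x`, `-1/2` for a `y` or a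
`z`. -/
theorem swapBracket_swapDet_tripleTuple {K : Type*} [Field K] [CharZero K]
    (H : FlagOrder o x y z v u) (hcond : l' ≤ l ∨ p ≤ p') :
    swapBracket K P (swapDet K (tripleTuple x y z hm hl hp h) v)
        (swapDet K (tripleTuple x y z hm' hl' hp' h') u)
      = algebraMap K _ (1 / 2 * ((min m m' : ℕ) : K) - 1 / 2 * ((min l l' : ℕ) : K)
            - 1 / 2 * ((min p p' : ℕ) : K)) *
          (swapDet K (tripleTuple x y z hm hl hp h) v
            * swapDet K (tripleTuple x y z hm' hl' hp' h') u) := by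
  -- `e t` records the side of the points `v` on which `t` lies: `-1` for `x`, `1` for `y` and `z`.
  let e : P → ℚ := fun t => open Classical in if t ∈ Set.range x then -1 else 1
  have hex : ∀ a, e (x a) = -1 := fun a => if_pos ⟨a, rfl⟩
  have hey : ∀ a, e (y a) = 1 := fun a => if_neg fun ⟨b, hb⟩ => H.x_ne_y b a hb
  have hez : ∀ a, e (z a) = 1 := fun a => if_neg fun ⟨b, hb⟩ => H.x_ne_z b a hb
  have hside : ∀ {m l p : ℕ} {hm : m ≤ N} {hl : l ≤ N} {hp : p ≤ N} {h : m + l + p = n} i j,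
      signature (coord o (tripleTuple x y z hm hl hp h i) - coord o (v j))
        = e (tripleTuple x y z hm hl hp h i) := by
    intro m l p hm hl hp h i j
    refine (forall_tripleTuple (Q := fun t => signature (coord o t - coord o (v j)) = e t)).mpr
      ⟨fun a _ => ?_, fun a _ => ?_, fun a _ => ?_⟩ i
    · rw [hex, signature_sub_eq_neg_one (H.x_lt_v a j)]
    · rw [hey, signature_sub_eq_one (H.v_lt_y j a)]
    · rw [hez, signature_sub_eq_one (H.v_lt_z j a)]
  have hlast : ∀ i j, coord o (tripleTuple x y z hm hl hp h i) < coord o (u j) := fun i j =>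
    (forall_tripleTuple (Q := fun t => coord o t < coord o (u j))).mpr
      ⟨fun a _ => H.x_lt_u a j, fun a _ => H.y_lt_u a j,
      fun a _ => H.z_lt_u a j⟩ i
  -- `F r s` is the linking number of `r v_j` and `s u_l`.
  let F : P → P → ℚ := fun r s => -(1 / 2) * e r * (1 + e s * signature (coord o r - coord o s))
  obtain ⟨hmx, hmy, hmz⟩ := (forall_tripleTuple (x := x) (y := y) (z := z) (hm := hm) (hl := hl)
    (hp := hp) (h := h) (Q := (· ∈ Set.range (tripleTuple x y z hm hl hp h)))).mp fun i => ⟨i, rfl⟩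
  obtain ⟨hmx', hmy', hmz'⟩ := (forall_tripleTuple (x := x) (y := y) (z := z) (hm := hm')
    (hl := hl') (hp := hp') (h := h')
    (Q := (· ∈ Set.range (tripleTuple x y z hm' hl' hp' h')))).mp fun i => ⟨i, rfl⟩
  rw [swapBracket_swapDet_eq_mul _ v _ u
    (fun i k => F (tripleTuple x y z hm hl hp h i) (tripleTuple x y z hm' hl' hp' h' k))
    (fun i j k l => linkingNumber_eq_of_lt (hlast i l) (H.v_lt_u j l) (hside i j) (hside k j))]
  · congr 2
    let G : P → P → ℚ := fun r s => if r = s then F r s else 0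
    have hG0 : ∀ r s, r ≠ s → G r s = 0 := fun r s hrs => if_neg hrs
    have hG : ∀ {w : Fin N → P} {c : ℚ}, Function.Injective w → (∀ a, e (w a) = c) →
        ∀ a b, G (w a) (w b) = if a = b then -(1 / 2) * c else 0 := by
      intro w c hw hc a b
      by_cases hab : a = b
      · rw [if_pos hab, hab]
        simp [G, F, signature_zero, hc]
      · rw [if_neg hab, hG0 _ _ fun h => hab (hw h)]
    change ((∑ k, ∑ i, G (tripleTuple x y z hm hl hp h i) (tripleTuple x y z hm' hl' hp' h' k) : ℚ)
      : K) = _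
    rw [sum_tripleTuple (F := fun s => ∑ i, G (tripleTuple x y z hm hl hp h i) s)]
    have hsum : ∀ s, ∑ i, G (tripleTuple x y z hm hl hp h i) s
        = ∑ a : Fin m, G (x (Fin.castLE hm a)) s + ∑ a : Fin l, G (y (Fin.castLE hl a)) s
          + ∑ a : Fin p, G (z (Fin.castLE hp a)) s := fun s => sum_tripleTuple (F := fun r => G r s)
    simp only [hsum, hG0 _ _ (H.x_ne_y _ _), hG0 _ _ (H.x_ne_z _ _), hG0 _ _ (H.y_ne_z _ _),
      hG0 _ _ (H.x_ne_y _ _).symm, hG0 _ _ (H.x_ne_z _ _).symm, hG0 _ _ (H.y_ne_z _ _).symm,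
      hG H.x_injective hex, hG H.y_injective hey, hG H.z_injective hez, Finset.sum_const_zero,
      add_zero, zero_add, sum_ite_castLE_eq]
    generalize min m m' = A, min l l' = B, min p p' = D
    push_cast
    ring
  · -- An exchange of a point missing from the second tuple with a point missing from the first one
    -- has linking number zero; one exception, a `z` against a `y`, needs `p' < p` and `l < l'`.
    intro i k
    refine (forall_tripleTuple (Q := fun r => tripleTuple x y z hm' hl' hp' h' k ∉ Set.range
      (tripleTuple x y z hm hl hp h) → r ∉ Set.range (tripleTuple x y z hm' hl' hp' h') →
        F r (tripleTuple x y z hm' hl' hp' h' k) = 0)).mpr ?_ i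
    refine (forall_tripleTuple (Q := fun s =>
      (∀ a : Fin N, (a : ℕ) < m → s ∉ Set.range (tripleTuple x y z hm hl hp h) →
        x a ∉ Set.range (tripleTuple x y z hm' hl' hp' h') → F (x a) s = 0) ∧
      (∀ a : Fin N, (a : ℕ) < l → s ∉ Set.range (tripleTuple x y z hm hl hp h) →
        y a ∉ Set.range (tripleTuple x y z hm' hl' hp' h') → F (y a) s = 0) ∧
      (∀ a : Fin N, (a : ℕ) < p → s ∉ Set.range (tripleTuple x y z hm hl hp h) →
        z a ∉ Set.range (tripleTuple x y z hm' hl' hp' h') → F (z a) s = 0))).mpr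
      ⟨fun b hb => ⟨?_, ?_, ?_⟩, fun b hb => ⟨?_, ?_, ?_⟩, fun b hb => ⟨?_, ?_, ?_⟩⟩ k <;>
      intro a ha hbn han
    · have h1 : ¬ (b : ℕ) < m := fun h => hbn (hmx b h)
      have h2 : ¬ (a : ℕ) < m' := fun h => han (hmx' a h)
      omega
    · simp [F, hex, signature_sub_eq_one (H.x_lt_y b a)]
    · simp [F, hex, signature_sub_eq_one (H.x_lt_z b a)]
    · simp [F, hey, signature_sub_eq_neg_one (H.x_lt_y a b)]
    · have h1 : ¬ (b : ℕ) < l := fun h => hbn (hmy b h)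
      have h2 : ¬ (a : ℕ) < l' := fun h => han (hmy' a h)
      omega
    · have h1 : ¬ (b : ℕ) < l := fun h => hbn (hmy b h)
      have h2 : ¬ (a : ℕ) < p' := fun h => han (hmz' a h)
      omega
    · simp [F, hez, signature_sub_eq_neg_one (H.x_lt_z a b)]
    · simp [F, hez, signature_sub_eq_neg_one (H.y_lt_z a b)]
    · have h1 : ¬ (b : ℕ) < p := fun h => hbn (hmz b h)
      have h2 : ¬ (a : ℕ) < p' := fun h => han (hmz' a h)
      omega

end FlagOrder

end Main

/-- For units, a bracket that is a scalar multiple of the product has that scalar as normalized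
bracket. -/
theorem normalizedBracket_rankDet {K : Type*} [Field K] [CharZero K] {P : Set UnitAddCircle}
    {n k k' : ℕ} {a v : Fin k → P} {b u : Fin k' → P} {c : K}
    (ha : IsUnit (rankDet K n a v)) (hb : IsUnit (rankDet K n b u))
    (h : swapBracket K P (swapDet K a v) (swapDet K b u)
      = algebraMap K _ c * (swapDet K a v * swapDet K b u)) :
    normalizedBracket (rankDet K n a v) (rankDet K n b u)
      = algebraMap K (RankFractionRing K P n) c := by
  have hbr : fractionBracket K P n (rankDet K n a v) (rankDet K n b u)
      = algebraMap K _ c * (rankDet K n a v * rankDet K n b u) := by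
    rw [rankDet, rankDet, fractionBracket_toFraction, h, map_mul, map_mul, AlgHom.commutes]
  rw [normalizedBracket, hbr, mul_assoc, Ring.mul_inverse_cancel _ (ha.mul hb), mul_one]

end Swapping

end

open Swapping in
theorem mainTheorem6 {K : Type*} [Field K] [CharZero K] (P : Set UnitAddCircle)
    (n : ℕ) (hn : 2 ≤ n)
    (x y z : Fin (n - 1) → P) (v u : Fin n → P)
    (hord : OrderedAnticlockwise
      (((List.ofFn x).reverse ++ List.ofFn v ++ (List.ofFn y).reverse ++ (List.ofFn z).reverse
        ++ List.ofFn u).map Subtype.val))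
    (m l p m' l' p' : ℕ)
    (hm : m ≤ n - 1) (hl : l ≤ n - 1) (hp : p ≤ n - 1)
    (hm' : m' ≤ n - 1) (hl' : l' ≤ n - 1) (hp' : p' ≤ n - 1)
    (h : m + l + p = n) (h' : m' + l' + p' = n)
    (hcond : l' ≤ l ∨ p ≤ p') :
    IsUnit (rankDet K n (tripleTuple x y z hm hl hp h) v) ∧
    IsUnit (rankDet K n (tripleTuple x y z hm' hl' hp' h') u) ∧
    normalizedBracket (rankDet K n (tripleTuple x y z hm hl hp h) v)
        (rankDet K n (tripleTuple x y z hm' hl' hp' h') u)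
      = algebraMap K (RankFractionRing K P n)
          (1 / 2 * ((min m m' : ℕ) : K) - 1 / 2 * ((min l l' : ℕ) : K)
            - 1 / 2 * ((min p p' : ℕ) : K)) := by
  obtain ⟨o, H⟩ := exists_flagOrder hord
  have hA := isUnit_rankDet (K := K) hn
    (H.tripleTuple_injective (hm := hm) (hl := hl) (hp := hp) (h := h)) H.v_injective
  have hB := isUnit_rankDet (K := K) hn
    (H.tripleTuple_injective (hm := hm') (hl := hl') (hp := hp') (h := h')) H.u_injective
  exact ⟨hA, hB, normalizedBracket_rankDet hA hB (H.swapBracket_swapDet_tripleTuple hcond)⟩
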